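/- **Setting.** Fix $d\ge 1$, $1\le p\le\infty$, a real $\rho\ge 1$ and an integer $r\ge 1$. For $n\ge1$ let $G_n$ be the graph on the torus $V_n=(\mathbb Z/n\mathbb Z)^d$ in which distinct $x,y$ are neighbors iff $\|y-x\|_p\le\rho$ (coordinates taken modulo $n$, with smallest absolute value); $E_n$ is its edge set, $\mathcal V$ its common vertex degree, $B(x,r)$ the ball of $G_n$ for the graph distance, and $\delta U$ the set of vertices outside $U$ having a neighbor in $U$. For reals $a,b$ the Ising model $\mu_{a,b}$ on $\{-1,+1\}^{V_n}$ is $$\mu_{a,b}(\sigma)=\frac1{Z_{a,b}}\exp\Big(a\sum_{x\in V_n}\sigma(x)+b\sum_{\{x,y\}\in E_n}\sigma(x)\sigma(y)\Big).$$ Given sequences $a(n),b(n)$ and $\zeta\in\{-1,+1\}^U$, $U\subset V_n$, let $V_+(\zeta)=\{x\in U:\zeta(x)=+1\}$, $k(\zeta)=|V_+(\zeta)|$, let $\gamma(\zeta)=\mathcal V k(\zeta)-2|\{\{x,y\}\in E_n: x,y\in V_+(\zeta)\}|$, and let the weight be $W_n(\zeta)=\exp(2a(n)k(\zeta)-2b(n)\gamma(\zeta))$.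 Let $\eta$ be a local configuration of radius $r$: a $\pm1$-valued function on the ball of radius $r$ around $0$ in the lattice $\mathbb Z^d$ with the same neighborhood rule (for $n>2\rho r$ this ball is identified with $B(0,r)$ in $G_n$). Let $\eta_x$ be its translate to $B(x,r)$, $W_n(\eta)=W_n(\eta_0)$, and let $X_n(\eta)$ be the number of $x\in V_n$ such that $\sigma$ restricted to $B(x,r)$ equals $\eta_x$. Put $$\Delta_n(\eta)=\max_{\sigma}\frac{W_n(\eta_0\sigma)}{W_n(\eta)},\qquad \Theta_n(\eta)=\max_{\eta'}\frac{W_n(\eta')}{W_n(\eta)},$$ where $\sigma$ runs over the configurations on $\delta B(0,r)$ that are not identically $-1$ and $\eta_0\sigma$ is the configuration on $B(0,r)\cup\delta B(0,r)$ equal to $\eta_0$ and $\sigma$ on the two parts, and where $\eta'$ runs over the configurations on $B(0,r)$ with $\eta'\ne\eta_0$ and $V_+(\eta')\supset V_+(\eta_0)$ (with $\Theta_n(\eta)=0$ if there is none). **Theorem 3.1.** Let $\lambda>0$ and let $n_0>2\rho(r+1)$ be an integer such that for all $n\ge n_0$: $a(n)<0$, $b(n)\ge0$ and $n^dW_n(\eta)=\lambda$.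 Assume (H1) $\displaystyle\lim_{n\to\infty}\max\{\Delta_n(\eta),\Theta_n(\eta)\}=0$; (H2) there are constants $C(m)>0$, $m\ge0$, such that for every finite $V\subset\mathbb Z^d$ there is $N(V)$ such that for all $n\ge N(V)$ and all configurations $\zeta$ on $V$ (regarded as a subset of $V_n$ by reduction modulo $n$), $$\mu_{a(n),b(n)}(\{\sigma:\sigma|_V=\zeta\})\le C(|V|)\,W_n(\zeta).$$ Then there is a constant $C>0$ such that for all $n\ge n_0$ the law of $X_n(\eta)$ under $\mu_{a(n),b(n)}$ satisfies $$d_{\mathrm{TV}}(\mathcal L(X_n(\eta)),\mathrm{Poisson}(\lambda))\le C\max\{\Delta_n(\eta),\Theta_n(\eta)\},$$ where $d_{\mathrm{TV}}(\mu,\nu)=\sup_A|\mu(A)-\nu(A)|$. -/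

import Mathlib

noncomputable section

namespace IsingPoisson

open scoped ENNReal NNReal

/-! ### Configurations on a finite graph

Spins are the elements `1` and `-1` of `ℤˣ`.  A configuration on a set `U` of vertices is a
function `U → ℤˣ`. -/

section Graph

open scoped Classical

/-- The energy `a * ∑ x, σ x + b * ∑ {x, y} ∈ E, σ x * σ y` (exponent of the Gibbs weight). -/
def energy {V : Type*} [Fintype V] (G : SimpleGraph V) (a b : ℝ) (σ : V → ℤˣ) : ℝ :=
  a * ∑ x, ((σ x : ℤ) : ℝ) +
    b * ∑ e ∈ G.edgeFinset, (Sym2.map (fun x => ((σ x : ℤ) : ℝ)) e).mul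

/-- The normalizing constant. -/
def partitionFn {V : Type*} [Fintype V] (G : SimpleGraph V) (a b : ℝ) : ℝ :=
  ∑ σ : V → ℤˣ, Real.exp (energy G a b σ)

theorem partitionFn_pos {V : Type*} [Fintype V] (G : SimpleGraph V) (a b : ℝ) :
    0 < partitionFn G a b :=
  Finset.sum_pos (fun _ _ => Real.exp_pos _) ⟨1, Finset.mem_univ _⟩

theorem sum_gibbs {V : Type*} [Fintype V] (G : SimpleGraph V) (a b : ℝ) :
    ∑ σ : V → ℤˣ, ENNReal.ofReal (Real.exp (energy G a b σ) / partitionFn G a b) = 1 := by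
  rw [← ENNReal.ofReal_sum_of_nonneg
    (fun _ _ => div_nonneg (Real.exp_pos _).le (partitionFn_pos G a b).le),
    ← Finset.sum_div]
  change ENNReal.ofReal (partitionFn G a b / partitionFn G a b) = 1
  rw [div_self (partitionFn_pos G a b).ne', ENNReal.ofReal_one]

/-- The Ising model (Gibbs measure) on `G` with magnetic field `a` and pair potential `b`. -/
def ising {V : Type*} [Fintype V] (G : SimpleGraph V) (a b : ℝ) : PMF (V → ℤˣ) :=
  PMF.ofFintype
    (fun σ => ENNReal.ofReal (Real.exp (energy G a b σ) / partitionFn G a b)) (sum_gibbs G a b)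

/-- The neighborhood `δU`: the vertices outside `U` that have a neighbor in `U`. -/
def boundary {V : Type*} [Fintype V] (G : SimpleGraph V) (U : Finset V) : Finset V :=
  Finset.univ.filter (fun y => y ∉ U ∧ ∃ x ∈ U, G.Adj x y)

/-- The ball `B(x, r)` for the graph distance. -/
def ball {V : Type*} [Fintype V] (G : SimpleGraph V) (x : V) (r : ℕ) : Finset V :=
  Finset.univ.filter (fun y => G.edist x y ≤ (r : ℕ∞))

/-- The set `V_+(ζ)` of positive vertices of a configuration `ζ` on `U`. -/
def posSet {V : Type*} {U : Finset V} (ζ : U → ℤˣ) : Finset V :=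
  (Finset.univ.filter (fun v : U => ζ v = 1)).map (Function.Embedding.subtype _)

/-- The number of edges of `G` with both ends in `P`. -/
def innerEdges {V : Type*} [Fintype V] (G : SimpleGraph V) (P : Finset V) : ℕ :=
  (G.edgeFinset.filter (fun e => ∀ v ∈ e, v ∈ P)).card

/-- The perimeter `γ(ζ) = deg * |V_+(ζ)| - 2 * |{edges inside V_+(ζ)}|`, where `deg` is the common
degree of the vertices. -/
def perimeter {V : Type*} [Fintype V] (G : SimpleGraph V) (deg : ℕ) {U : Finset V}
    (ζ : U → ℤˣ) : ℝ :=
  (deg : ℝ) * ((posSet ζ).card : ℝ) - 2 * (innerEdges G (posSet ζ) : ℝ)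

/-- The configuration `ζσ` on the union of two disjoint sets. -/
def glue {V : Type*} {U U' : Finset V} (ζ : U → ℤˣ) (σ : U' → ℤˣ) : ↥(U ∪ U') → ℤˣ :=
  fun v => if h : (v : V) ∈ U then ζ ⟨v, h⟩
    else σ ⟨v, (Finset.mem_union.mp v.2).resolve_left h⟩

end Graph

/-! ### The lattice torus -/

/-- The vertex set of the `d`-dimensional torus of size `n`. -/
abbrev Torus (d : ℕ) (n : ℕ+) : Type := Fin d → ZMod (n : ℕ)

/-- The `L_p` length of a vertex of the torus, coordinates being measured modulo `n`
(by the distance to the nearest multiple of `n`). -/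
def torusNorm {d : ℕ} (p : ℝ≥0∞) {n : ℕ+} (x : Torus d n) : ℝ :=
  ‖(WithLp.toLp p (fun i => (((x i).valMinAbs.natAbs : ℕ) : ℝ)) : PiLp p (fun _ : Fin d => ℝ))‖

/-- The graph `G_n`: distinct vertices `x`, `y` are neighbors iff `‖y - x‖_p ≤ ρ`. -/
def torusGraph (d : ℕ) (p : ℝ≥0∞) (ρ : ℝ) (n : ℕ+) : SimpleGraph (Torus d n) where
  Adj x y := x ≠ y ∧ torusNorm p (y - x) ≤ ρ
  symm := ⟨by
    rintro x y ⟨hne, h⟩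
    refine ⟨hne.symm, ?_⟩
    have e : torusNorm p (x - y) = torusNorm p (y - x) := by
      unfold torusNorm
      have hc : ∀ i, ((x - y) i).valMinAbs.natAbs = ((y - x) i).valMinAbs.natAbs := by
        intro i
        rw [← neg_sub y x, Pi.neg_apply, ZMod.natAbs_valMinAbs_neg]
      simp only [hc]
    rw [e]
    exact h⟩
  loopless := ⟨fun _ h => h.1 rfl⟩

open scoped Classical in
/-- The number of neighbors of a vertex of `G_n` (the same for all vertices). -/
def torusDegree (d : ℕ) (p : ℝ≥0∞) (ρ : ℝ) (n : ℕ+) : ℕ := (torusGraph d p ρ n).degree 0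

/-- The weight `exp (2 a k(ζ) - 2 b γ(ζ))` of a configuration on a subset `U` of the torus. -/
def weight {d : ℕ} (p : ℝ≥0∞) (ρ a b : ℝ) {n : ℕ+} {U : Finset (Torus d n)} (ζ : U → ℤˣ) : ℝ :=
  Real.exp (2 * a * ((posSet ζ).card : ℝ)
    - 2 * b * perimeter (torusGraph d p ρ n) (torusDegree d p ρ n) ζ)

/-- The translate `η_x` on the ball `B(x, r)` of `G_n`, given by `η_x (x + y) = η y`.
A local configuration of radius `r` is the restriction of `η : ℤ^d → {-1, 1}` to the ball
`B(0, r)` of the lattice; for `n > 2ρr` the coordinates of `v - x`, taken in `(-n/2, n/2]`,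
identify `B(x, r)` in `G_n` with that ball, and no other value of `η` is used. -/
def translate {d : ℕ} (p : ℝ≥0∞) (ρ : ℝ) (n : ℕ+) (η : (Fin d → ℤ) → ℤˣ) (r : ℕ)
    (x : Torus d n) : ball (torusGraph d p ρ n) x r → ℤˣ :=
  fun v => η (fun i => ((v : Torus d n) i - x i).valMinAbs)

/-- The weight `W_n(η)` of a local configuration. -/
def localWeight {d : ℕ} (p : ℝ≥0∞) (ρ a b : ℝ) (n : ℕ+) (η : (Fin d → ℤ) → ℤˣ) (r : ℕ) : ℝ :=
  weight p ρ a b (translate p ρ n η r 0)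

open scoped Classical in
/-- The number `X_n(η)` of occurrences of `η` in the configuration `σ`. -/
def occurrences {d : ℕ} (p : ℝ≥0∞) (ρ : ℝ) (n : ℕ+) (η : (Fin d → ℤ) → ℤˣ) (r : ℕ)
    (σ : Torus d n → ℤˣ) : ℕ :=
  ∑ x : Torus d n,
    if (fun v : ball (torusGraph d p ρ n) x r => σ v) = translate p ρ n η r x then 1 else 0

/-- The probability gap `Δ_n(η)`: the maximum of `W_n(ησ) / W_n(η)` over the configurations `σ`
on `δB(0, r)` that are not null (a finite family). -/
def probGap {d : ℕ} (p : ℝ≥0∞) (ρ a b : ℝ) (n : ℕ+) (η : (Fin d → ℤ) → ℤˣ) (r : ℕ) : ℝ :=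
  ⨆ σ : {σ : boundary (torusGraph d p ρ n) (ball (torusGraph d p ρ n) 0 r) → ℤˣ //
      σ ≠ fun _ => -1},
    weight p ρ a b (glue (translate p ρ n η r 0) σ.1) / localWeight p ρ a b n η r

/-- The maximality probability `Θ_n(η)`: the maximum of `W_n(η') / W_n(η)` over the `η' ≠ η`
on `B(0, r)` with `V_+(η') ⊇ V_+(η)` (a finite family; the maximum is `0` if it is empty). -/
def maxProb {d : ℕ} (p : ℝ≥0∞) (ρ a b : ℝ) (n : ℕ+) (η : (Fin d → ℤ) → ℤˣ) (r : ℕ) : ℝ :=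
  ⨆ η' : {η' : ball (torusGraph d p ρ n) 0 r → ℤˣ //
      posSet (translate p ρ n η r 0) ⊆ posSet η' ∧ η' ≠ translate p ρ n η r 0},
    weight p ρ a b η'.1 / localWeight p ρ a b n η r

open scoped Classical in
/-- The subset of the torus of size `n` given by a fixed finite set of lattice points. -/
def reduceSet {d : ℕ} (n : ℕ+) (V : Finset (Fin d → ℤ)) : Finset (Torus d n) :=
  V.image (fun v i => ((v i : ℤ) : ZMod (n : ℕ)))

/-- Hypothesis (H1). -/
def HypGap {d : ℕ} (p : ℝ≥0∞) (ρ : ℝ) (a b : ℕ+ → ℝ) (η : (Fin d → ℤ) → ℤˣ) (r : ℕ) : Prop :=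
  Filter.Tendsto
    (fun n : ℕ+ => max (probGap p ρ (a n) (b n) n η r) (maxProb p ρ (a n) (b n) n η r))
    Filter.atTop (nhds 0)

/-- Hypothesis (H2): there are constants `C(m) > 0` such that for every fixed finite set `V` of
vertices, for all `n` large enough (depending on `V`), every configuration `ζ` on `V` has
probability at most `C(|V|) * W_n(ζ)`. -/
def HypWeight (d : ℕ) (p : ℝ≥0∞) (ρ : ℝ) (a b : ℕ+ → ℝ) : Prop :=
  ∃ C : ℕ → ℝ, (∀ m, 0 < C m) ∧
    ∀ V : Finset (Fin d → ℤ), ∃ N : ℕ+, ∀ n : ℕ+, N ≤ n → ∀ ζ : reduceSet n V → ℤˣ,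
      ((ising (torusGraph d p ρ n) (a n) (b n)).toOuterMeasure
          {σ | (fun v : reduceSet n V => σ v) = ζ}).toReal
        ≤ C V.card * weight p ρ (a n) (b n) ζ

/-- The total variation distance `sup_A |μ(A) - ν(A)|` over measurable sets `A`. -/
def tvDist {Ω : Type*} [MeasurableSpace Ω] (μ ν : MeasureTheory.Measure Ω) : ℝ :=
  ⨆ A : {A : Set Ω // MeasurableSet A}, |μ.real A.1 - ν.real A.1|

/-- The law of `X_n(η)` under the Ising model on `G_n`. -/
def occurrencesLaw {d : ℕ} (p : ℝ≥0∞) (ρ a b : ℝ) (n : ℕ+) (η : (Fin d → ℤ) → ℤˣ) (r : ℕ) :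
    MeasureTheory.Measure ℕ :=
  ((ising (torusGraph d p ρ n) a b).map (occurrences p ρ n η r)).toMeasure

end IsingPoisson

end

/-!
The proof is the Chen–Stein method for locally dependent events, applied to the Ising model written
as a probability measure on the sets `T` of positive vertices. On a regular graph the mass of `T` is
proportional to its weight `W(T) = exp (2 a |T| - 2 b γ(T))` (`energy_eq`), and the weight is
multiplicative on sets without edges between them (`clusterWeight_union`).

An occurrence of `η` at `x` is called isolated if all vertices of `δB(x, r)` are negative. Put
`W = W_n(η) = λ / n ^ d`, and let `w₁` be the weight of a single positive vertex. Two facts compare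
all error terms with `Δ_n(η)`. By isoperimetry (`torusDegree_le_perimeter`), every nonempty set of
bounded diameter has weight at most `w₁`; and `w₁ ≤ Δ_n(η)` (`exp_le_probGap`), since one more
positive vertex on the boundary multiplies the weight by at least `w₁`.

* The multiplicativity of the weight gives an exact Markov property
  (`sum_clusterMass_eq_of_boundary`): given that `δB(x, r)` is negative, the spins in `B(x, r)` are
  independent of those outside, and show `η_x` with probability `W / Z`. Here `1 ≤ Z ≤ 1 + O(w₁)`,
  and the boundary is negative with probability `1 - O(w₁)`. Hence an isolated occurrence at `x` is
  independent of the outside up to an error `O(W w₁)` (`abs_sub_sum_isolatedAt_le`).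
* If there are isolated occurrences at `x` and at a nearby `y ≠ x`, the positive vertices of `η_y`
  not in `η_x` form a nonempty cluster that is not adjacent to `B(x, r)`; so this event has
  probability `O(W w₁)` (`sum_isolatedAt_inter_le`).
* An occurrence that is not isolated has probability `O(W Δ_n(η))` at each `x`, by the definition of
  `Δ_n(η)` (`sum_not_isolatedAt_le`).

Summation over the `n ^ d = λ / W` vertices gives the bound `O(Δ_n(η))` for all large `n`. In the
Stein equation only a uniform bound of the solution is used, not one of its increments. The finitely
many remaining `n` are absorbed into the constant because `Δ_n(η) > 0` for all `n ≥ n₀`.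
-/

noncomputable section

namespace IsingPoisson

open scoped ENNReal NNReal

/-! ### The Stein equation of the Poisson distribution -/

/-- For `h` of mean zero under the Poisson distribution, the Stein equation is solved by
`f (j + 1) = -(∑ k > j, h k * p k) / (lam * p j)`, where `p k` are the Poisson weights. The ratio
`(∑ k > j, p k) / p j` is at most `exp lam`, because `j! * k! ≤ (j + k)!`. -/
theorem exists_stein_solution_of_hasSum {lam : ℝ} (hlam : 0 < lam) {h : ℕ → ℝ}
    (hb : ∀ k, |h k| ≤ 1) (h0 : HasSum (fun k => h k * (lam ^ k / (k.factorial : ℝ))) 0) :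
    ∃ f : ℕ → ℝ, (∀ j, |f j| ≤ Real.exp lam / lam) ∧
      ∀ j : ℕ, lam * f (j + 1) - j * f j = h j := by
  set p : ℕ → ℝ := fun k => lam ^ k / (k.factorial : ℝ) with hp
  have hpos : ∀ k, 0 < p k := fun k => by positivity
  have hps : HasSum p (Real.exp lam) := by
    have := NormedSpace.expSeries_div_hasSum_exp lam
    rwa [← Real.exp_eq_exp_ℝ] at this
  have hs : Summable (fun k => h k * p k) := h0.summable
  set T : ℕ → ℝ := fun j => ∑' k, h (k + j) * p (k + j) with hT
  have hsj : ∀ j, Summable (fun k => h (k + j) * p (k + j)) := fun j =>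
    (summable_nat_add_iff (f := fun k => h k * p k) j).2 hs
  have hT0 : T 0 = 0 := by simpa [hT] using h0.tsum_eq
  have hstep : ∀ j, T j = h j * p j + T (j + 1) := by
    intro j
    simp only [hT]
    rw [(hsj j).tsum_eq_zero_add]
    simp only [zero_add]
    congr 1
    refine tsum_congr fun k => ?_
    rw [show k + 1 + j = k + (j + 1) by ring]
  have hpstep : ∀ j : ℕ, ((j : ℝ) + 1) * p (j + 1) = lam * p j := by
    intro j
    simp only [hp, Nat.factorial_succ, pow_succ]
    push_cast
    have : ((j.factorial : ℕ) : ℝ) ≠ 0 := by positivity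
    field_simp
  have hpbound : ∀ j k, p (k + j) ≤ p j * p k := by
    intro j k
    simp only [hp]
    rw [pow_add, div_mul_div_comm, mul_comm (lam ^ k)]
    gcongr
    have := Nat.le_of_dvd (Nat.factorial_pos _) (Nat.factorial_mul_factorial_dvd_factorial_add k j)
    rw [mul_comm]
    exact_mod_cast this
  have hTb : ∀ j, |T (j + 1)| ≤ p j * Real.exp lam := by
    intro j
    have hmaj : HasSum (fun k => p j * p (k + 1)) (p j * (Real.exp lam - 1)) := by
      refine HasSum.mul_left _ ?_
      have := (hasSum_nat_add_iff' (f := p) 1).2 hps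
      simpa [hp] using this
    have h1 : ‖T (j + 1)‖ ≤ p j * (Real.exp lam - 1) := by
      refine tsum_of_norm_bounded hmaj fun k => ?_
      rw [Real.norm_eq_abs, abs_mul, abs_of_pos (hpos _)]
      calc |h (k + (j + 1))| * p (k + (j + 1)) ≤ 1 * p (k + (j + 1)) := by
            gcongr
            exacts [hb _]
        _ = p ((k + 1) + j) := by rw [one_mul, show k + (j + 1) = k + 1 + j by ring]
        _ ≤ p j * p (k + 1) := hpbound _ _
    rw [Real.norm_eq_abs] at h1
    have := hpos j
    linarith
  refine ⟨fun j => if j = 0 then 0 else -T j / (lam * p (j - 1)), ?_, ?_⟩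
  · rintro (_ | j)
    · simp only [if_true, abs_zero]
      positivity
    · have := hpos j
      simp only [Nat.succ_ne_zero, if_false, Nat.add_sub_cancel]
      rw [abs_div, abs_neg, abs_of_pos (mul_pos hlam this), div_le_div_iff₀ (by positivity) hlam]
      nlinarith [hTb j]
  · rintro (_ | j)
    · have h1 := hstep 0
      have h2 := hpos 0
      rw [hT0] at h1
      simp only [Nat.succ_ne_zero, if_false, if_true, Nat.add_sub_cancel, Nat.cast_zero, zero_mul,
        sub_zero]
      field_simp
      linarith
    · have h1 := hstep (j + 1)
      have h2 := hpos j
      have h3 := hpos (j + 1)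
      have h4 := hpstep j
      simp only [Nat.succ_ne_zero, if_false, Nat.add_sub_cancel]
      rw [← h4]
      push_cast
      field_simp
      linarith

theorem exists_stein_solution {lam : ℝ≥0} (hlam : 0 < lam) (A : Set ℕ) :
    ∃ f : ℕ → ℝ, (∀ j, |f j| ≤ Real.exp lam / lam) ∧
      ∀ j : ℕ, (lam : ℝ) * f (j + 1) - j * f j =
        A.indicator 1 j - (ProbabilityTheory.poissonMeasure lam).real A := by
  have hl : (0 : ℝ) < lam := hlam
  set μ := ProbabilityTheory.poissonMeasure lam
  have h1 := ProbabilityTheory.hasSum_one_poissonMeasure lam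
  have hA : HasSum (fun n : ℕ => Real.exp (-lam) * lam ^ n / (n.factorial : ℝ) *
      A.indicator 1 n) (μ.real A) := by
    have := ProbabilityTheory.hasSum_integral_poissonMeasure (r := lam)
      (f := A.indicator (1 : ℕ → ℝ)) ((MeasureTheory.integrable_const 1).indicator .of_discrete)
    rwa [MeasureTheory.integral_indicator_one .of_discrete] at this
  have hμ0 : 0 ≤ μ.real A := MeasureTheory.measureReal_nonneg
  have hμ1 : μ.real A ≤ 1 := MeasureTheory.measureReal_le_one
  refine exists_stein_solution_of_hasSum hl (fun k => ?_) ?_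
  · by_cases hk : k ∈ A <;> simp only [hk, Set.indicator_of_mem, Set.indicator_of_notMem,
      not_false_eq_true, Pi.one_apply, abs_le] <;> constructor <;> linarith
  · have := ((hA.sub (h1.mul_left (μ.real A))).mul_left (Real.exp lam))
    rw [mul_one, sub_self, mul_zero] at this
    have he : Real.exp lam * Real.exp (-lam) = 1 := by rw [← Real.exp_add]; simp
    have hfun : (fun k : ℕ => (A.indicator 1 k - μ.real A) * ((lam : ℝ) ^ k / (k.factorial : ℝ))) =
        fun k => Real.exp lam * (Real.exp (-lam) * lam ^ k / (k.factorial : ℝ) * A.indicator 1 k -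
          μ.real A * (Real.exp (-lam) * lam ^ k / (k.factorial : ℝ))) := by
      funext k
      linear_combination -(A.indicator 1 k - μ.real A) * ((lam : ℝ) ^ k / (k.factorial : ℝ)) * he
    rw [hfun]
    exact this

/-! ### The Chen–Stein method for locally dependent events -/

/-- The Chen–Stein bound for the number `S` of the events `J x` that occur. The hypothesis `hmark`
says that `J x` is, up to an error `e`, independent of the events `J y`, `y ∉ N x`, with
probability `w`. In `lam * f (S + 1) - S * f S = ∑ x, (w * f (S + 1) - 1_{J x} * f S)`, the number
`S` is replaced by the number of events outside `N x`, plus `1` in the second term; the replacement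
has an effect only if one of the other events in `N x` occurs. -/
theorem chen_stein_bound {Ω V : Type*} [Fintype Ω] [DecidableEq Ω] [Fintype V] [DecidableEq V]
    {m : Ω → ℝ} (hm : ∀ T, 0 ≤ m T) (J : V → Finset Ω)
    (N : V → Finset V) (hN : ∀ x, x ∈ N x) {lam w c e : ℝ} (hw : 0 ≤ w)
    (hlam : Fintype.card V * w = lam) {f : ℕ → ℝ} (hf : ∀ j, |f j| ≤ c)
    (hmark : ∀ x, ∀ g : ℕ → ℝ, (∀ j, |g j| ≤ c) →
      |w * ∑ T, m T * g (∑ y ∈ (N x)ᶜ, if T ∈ J y then 1 else 0) -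
        ∑ T ∈ J x, m T * g (∑ y ∈ (N x)ᶜ, if T ∈ J y then 1 else 0)| ≤ c * e) :
    |∑ T, m T * (lam * f ((∑ y, if T ∈ J y then 1 else 0) + 1) -
        ((∑ y, if T ∈ J y then 1 else 0 : ℕ) : ℝ) * f (∑ y, if T ∈ J y then 1 else 0))| ≤
      c * ∑ x, (2 * w * ∑ y ∈ N x, ∑ T ∈ J y, m T +
        2 * ∑ y ∈ (N x).erase x, ∑ T ∈ J x ∩ J y, m T + e) := by
  have hc : 0 ≤ c := (abs_nonneg _).trans (hf 0)
  set S : Ω → ℕ := fun T => ∑ y, if T ∈ J y then 1 else 0 with hS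
  set R : V → Ω → ℕ := fun x T => ∑ y ∈ (N x)ᶜ, if T ∈ J y then 1 else 0 with hR
  -- Two values of `f` differ by at most `2 c`, and not at all at equal arguments
  have hdiff : ∀ i j k : ℕ, j = i + k → |f j - f i| ≤ 2 * c * k := by
    rintro i j k rfl
    rcases Nat.eq_zero_or_pos k with rfl | hk
    · simp
    · have h1 : (1 : ℝ) ≤ k := by exact_mod_cast hk
      calc |f (i + k) - f i| ≤ |f (i + k)| + |f i| := abs_sub _ _
        _ ≤ c + c := add_le_add (hf _) (hf _)
        _ ≤ 2 * c * k := by nlinarith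
  have hSR : ∀ x T, S T = R x T + ∑ y ∈ N x, if T ∈ J y then 1 else 0 := by
    intro x T
    simp only [hS, hR]
    rw [add_comm, Finset.sum_add_sum_compl]
  have hsplit : ∑ T, m T * (lam * f (S T + 1) - (S T : ℝ) * f (S T)) =
      ∑ x, (w * ∑ T, m T * f (S T + 1) - ∑ T ∈ J x, m T * f (S T)) := by
    have h1 : ∀ x, ∑ T ∈ J x, m T * f (S T) =
        ∑ T, (if T ∈ J x then 1 else 0) * (m T * f (S T)) := by
      intro x
      simp [Finset.sum_ite_mem]
    rw [Finset.sum_sub_distrib, Finset.sum_const, Finset.card_univ, nsmul_eq_mul, ← mul_assoc, hlam]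
    simp only [h1]
    rw [Finset.sum_comm, Finset.mul_sum, ← Finset.sum_sub_distrib]
    refine Finset.sum_congr rfl fun T _ => ?_
    rw [← Finset.sum_mul]
    have : (S T : ℝ) = ∑ x, if T ∈ J x then 1 else 0 := by
      simp only [hS]
      push_cast
      rfl
    rw [this]
    ring
  rw [hsplit]
  conv_rhs => rw [Finset.mul_sum]
  refine (Finset.abs_sum_le_sum_abs _ _).trans (Finset.sum_le_sum fun x _ => ?_)
  have hA : |∑ T, m T * f (S T + 1) - ∑ T, m T * f (R x T + 1)| ≤
      2 * c * ∑ y ∈ N x, ∑ T ∈ J y, m T := by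
    rw [← Finset.sum_sub_distrib]
    refine (Finset.abs_sum_le_sum_abs _ _).trans ?_
    have : ∀ y ∈ N x, ∑ T ∈ J y, m T = ∑ T, m T * (if T ∈ J y then 1 else 0) := by
      intro y _
      simp [Finset.sum_ite_mem]
    rw [Finset.sum_congr rfl this, Finset.sum_comm, Finset.mul_sum]
    refine Finset.sum_le_sum fun T _ => ?_
    rw [← mul_sub, abs_mul, abs_of_nonneg (hm T), ← Finset.mul_sum]
    have := hdiff (R x T + 1) (S T + 1) (∑ y ∈ N x, if T ∈ J y then 1 else 0)
      (by rw [hSR x T]; ring)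
    push_cast at this
    nlinarith [mul_le_mul_of_nonneg_left this (hm T)]
  have hB : |∑ T ∈ J x, m T * f (R x T + 1) - ∑ T ∈ J x, m T * f (S T)| ≤
      2 * c * ∑ y ∈ (N x).erase x, ∑ T ∈ J x ∩ J y, m T := by
    rw [← Finset.sum_sub_distrib]
    refine (Finset.abs_sum_le_sum_abs _ _).trans ?_
    have : ∀ y ∈ (N x).erase x, ∑ T ∈ J x ∩ J y, m T =
        ∑ T ∈ J x, m T * (if T ∈ J y then 1 else 0) := by
      intro y _
      simp
    rw [Finset.sum_congr rfl this, Finset.sum_comm, Finset.mul_sum]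
    refine Finset.sum_le_sum fun T hT => ?_
    rw [← mul_sub, abs_mul, abs_of_nonneg (hm T), ← Finset.mul_sum, abs_sub_comm]
    have := hdiff (R x T + 1) (S T) (∑ y ∈ (N x).erase x, if T ∈ J y then 1 else 0)
      (by rw [hSR x T, ← Finset.add_sum_erase _ _ (hN x), if_pos hT]; ring)
    push_cast at this
    nlinarith [mul_le_mul_of_nonneg_left this (hm T)]
  have hC := hmark x (fun j => f (j + 1)) (fun j => hf _)
  rw [abs_le] at hA hB hC ⊢
  obtain ⟨hA1, hA2⟩ := hA
  obtain ⟨hB1, hB2⟩ := hB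
  obtain ⟨hC1, hC2⟩ := hC
  have hA1' := mul_le_mul_of_nonneg_left hA1 hw
  have hA2' := mul_le_mul_of_nonneg_left hA2 hw
  constructor <;> simp only [hR] at * <;> linarith

/-! ### The Ising model as a measure on the sets of positive vertices -/

section Cluster

open scoped Classical

variable {V : Type*} [Fintype V]

/-- The weight `exp (2 a |P| - 2 b γ(P))` of a finite set `P` of vertices, that is the weight of
a configuration whose set of positive vertices is `P`. -/
def clusterWeight (G : SimpleGraph V) (k : ℕ) (a b : ℝ) (P : Finset V) : ℝ :=
  Real.exp (2 * a * (P.card : ℝ) - 2 * b * ((k : ℝ) * (P.card : ℝ) - 2 * (innerEdges G P : ℝ)))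

/-- The probability of the configuration with set of positive vertices `T`. -/
def clusterMass (G : SimpleGraph V) (k : ℕ) (a b : ℝ) (T : Finset V) : ℝ :=
  clusterWeight G k a b T / ∑ T', clusterWeight G k a b T'

/-- The set of positive vertices of a configuration on the whole graph. -/
def plusSet (σ : V → ℤˣ) : Finset V := Finset.univ.filter (fun x => σ x = 1)

/-- The configuration with a given set of positive vertices. -/
def configOf (T : Finset V) : V → ℤˣ := fun x => if x ∈ T then 1 else -1

theorem mem_plusSet {σ : V → ℤˣ} {x : V} : x ∈ plusSet σ ↔ σ x = 1 := by simp [plusSet]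

theorem units_int_ne_one {u : ℤˣ} : u ≠ 1 ↔ u = -1 := by
  rcases Int.units_eq_one_or u with rfl | rfl <;> decide

theorem eq_of_eq_one_iff {u v : ℤˣ} (h : u = 1 ↔ v = 1) : u = v := by
  rcases Int.units_eq_one_or u with rfl | rfl <;> rcases Int.units_eq_one_or v with rfl | rfl <;>
    simp_all

/-- Configurations correspond to their sets of positive vertices. -/
def configEquiv (V : Type*) [Fintype V] : (V → ℤˣ) ≃ Finset V where
  toFun := plusSet
  invFun := configOf
  left_inv σ := by
    funext x
    by_cases h : σ x = 1
    · simp [configOf, mem_plusSet, h]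
    · simp [configOf, mem_plusSet, units_int_ne_one.1 h]
  right_inv T := by
    ext x
    by_cases h : x ∈ T <;> simp [configOf, mem_plusSet, h]

variable (G : SimpleGraph V)

/-- A sum over edges as half a sum over ordered pairs of neighbors. -/
theorem two_mul_sum_edgeFinset (f : Sym2 V → ℝ) :
    2 * ∑ e ∈ G.edgeFinset, f e = ∑ x, ∑ y, if G.Adj x y then f s(x, y) else 0 := by
  have h1 : ∑ d : G.Dart, f d.edge = ∑ e ∈ G.edgeFinset, 2 * f e := by
    rw [← Finset.sum_fiberwise_of_maps_to (s := Finset.univ) (t := G.edgeFinset)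
      (g := fun d : G.Dart => d.edge) (fun d _ => by simp)]
    refine Finset.sum_congr rfl fun e he => ?_
    rw [Finset.sum_congr rfl (g := fun _ => f e) (fun d hd => by
      rw [(Finset.mem_filter.1 hd).2]), Finset.sum_const,
      G.dart_edge_fiber_card e (by simpa using he)]
    simp
  rw [Finset.mul_sum, ← h1, ← Finset.sum_product', ← Finset.sum_filter]
  refine Finset.sum_bij (fun d _ => d.toProd) ?_ ?_ ?_ ?_
  · intro d _
    simp
  · intro d _ d' _ h
    exact SimpleGraph.Dart.ext _ _ h
  · rintro ⟨x, y⟩ h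
    exact ⟨⟨(x, y), by simpa using h⟩, Finset.mem_univ _, rfl⟩
  · intro d _
    rfl

theorem two_mul_innerEdges (P : Finset V) :
    2 * (innerEdges G P : ℝ) = ∑ x ∈ P, ∑ y ∈ P, if G.Adj x y then 1 else 0 := by
  have h := two_mul_sum_edgeFinset G (fun e => if ∀ v ∈ e, v ∈ P then (1 : ℝ) else 0)
  rw [Finset.sum_boole] at h
  rw [innerEdges, h, ← Finset.sum_subset (Finset.subset_univ P)]
  · refine Finset.sum_congr rfl fun x hx => ?_
    rw [← Finset.sum_subset (Finset.subset_univ P)]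
    · refine Finset.sum_congr rfl fun y hy => ?_
      simp [hx, hy]
    · intro y _ hy
      simp [hy]
  · intro x _ hx
    simp [hx]

theorem innerEdges_mono {P P' : Finset V} (h : P ⊆ P') : innerEdges G P ≤ innerEdges G P' :=
  Finset.card_le_card (Finset.monotone_filter_right _ fun _ _ he v hv => h (he v hv))

theorem innerEdges_union [DecidableEq V] {P P' : Finset V} (hd : Disjoint P P')
    (hn : ∀ x ∈ P, ∀ y ∈ P', ¬ G.Adj x y) :
    (innerEdges G (P ∪ P') : ℝ) = innerEdges G P + innerEdges G P' := by
  have h := two_mul_innerEdges G (P ∪ P')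
  have h1 := two_mul_innerEdges G P
  have h2 := two_mul_innerEdges G P'
  rw [Finset.sum_union hd] at h
  simp only [Finset.sum_union hd, Finset.sum_add_distrib] at h
  have h3 : ∑ x ∈ P, ∑ y ∈ P', (if G.Adj x y then (1 : ℝ) else 0) = 0 :=
    Finset.sum_eq_zero fun x hx => Finset.sum_eq_zero fun y hy => if_neg (hn x hx y hy)
  have h4 : ∑ x ∈ P', ∑ y ∈ P, (if G.Adj x y then (1 : ℝ) else 0) = 0 :=
    Finset.sum_eq_zero fun x hx => Finset.sum_eq_zero fun y hy =>
      if_neg fun h => hn y hy x hx h.symm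
  linarith

variable {G} {k : ℕ} {a b : ℝ}

theorem clusterWeight_pos (P : Finset V) : 0 < clusterWeight G k a b P := Real.exp_pos _

theorem clusterWeight_empty : clusterWeight G k a b ∅ = 1 := by
  have : innerEdges G ∅ = 0 := by
    have := two_mul_innerEdges G ∅
    simpa using this
  simp [clusterWeight, this]

theorem clusterWeight_singleton (z : V) :
    clusterWeight G k a b {z} = Real.exp (2 * a - 2 * b * k) := by
  have : innerEdges G {z} = 0 := by
    have := two_mul_innerEdges G {z}
    simpa [Finset.filter_singleton] using this
  simp [clusterWeight, this]

/-- The weight is multiplicative on sets without edges between them. -/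
theorem clusterWeight_union [DecidableEq V] {P P' : Finset V} (hd : Disjoint P P')
    (hn : ∀ x ∈ P, ∀ y ∈ P', ¬ G.Adj x y) :
    clusterWeight G k a b (P ∪ P') = clusterWeight G k a b P * clusterWeight G k a b P' := by
  rw [clusterWeight, clusterWeight, clusterWeight, ← Real.exp_add, innerEdges_union G hd hn,
    Finset.card_union_of_disjoint hd]
  push_cast
  ring_nf

/-- A further positive vertex multiplies the weight by at least the weight of a single vertex. -/
theorem le_clusterWeight_insert [DecidableEq V] (hb : 0 ≤ b) {P : Finset V} {z : V} (hz : z ∉ P) :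
    clusterWeight G k a b P * Real.exp (2 * a - 2 * b * k) ≤
      clusterWeight G k a b (insert z P) := by
  rw [clusterWeight, clusterWeight, ← Real.exp_add, Real.exp_le_exp, Finset.card_insert_of_notMem hz]
  have : (innerEdges G P : ℝ) ≤ innerEdges G (insert z P) := by
    exact_mod_cast innerEdges_mono G (Finset.subset_insert z P)
  push_cast
  nlinarith [mul_le_mul_of_nonneg_left this hb]

/-- The weight of a nonempty set with perimeter at least `k` is at most that of a single vertex. -/
theorem clusterWeight_le_of_perimeter (ha : a ≤ 0) (hb : 0 ≤ b) {P : Finset V} (hP : P.Nonempty)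
    (h : (k : ℝ) ≤ k * P.card - 2 * innerEdges G P) :
    clusterWeight G k a b P ≤ Real.exp (2 * a - 2 * b * k) := by
  rw [clusterWeight, Real.exp_le_exp]
  have : (1 : ℝ) ≤ P.card := by exact_mod_cast hP.card_pos
  nlinarith [mul_le_mul_of_nonneg_left h hb]

theorem sum_clusterWeight_pos : 0 < ∑ T, clusterWeight G k a b T :=
  Finset.sum_pos (fun _ _ => clusterWeight_pos _) ⟨∅, Finset.mem_univ _⟩

theorem clusterMass_nonneg (T : Finset V) : 0 ≤ clusterMass G k a b T :=
  div_nonneg (clusterWeight_pos _).le sum_clusterWeight_pos.le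

theorem sum_clusterMass : ∑ T, clusterMass G k a b T = 1 := by
  simp only [clusterMass]
  rw [← Finset.sum_div, div_self sum_clusterWeight_pos.ne']

theorem clusterWeight_map (φ : G ≃g G) (P : Finset V) :
    clusterWeight G k a b (P.map φ.toEquiv.toEmbedding) = clusterWeight G k a b P := by
  have : 2 * (innerEdges G (P.map φ.toEquiv.toEmbedding) : ℝ) = 2 * (innerEdges G P : ℝ) := by
    rw [two_mul_innerEdges, two_mul_innerEdges, Finset.sum_map]
    refine Finset.sum_congr rfl fun x _ => ?_
    rw [Finset.sum_map]
    refine Finset.sum_congr rfl fun y _ => ?_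
    have : G.Adj (φ x) (φ y) ↔ G.Adj x y := φ.map_adj_iff
    simpa using if_congr this rfl rfl
  rw [clusterWeight, clusterWeight, this, Finset.card_map]

theorem sum_clusterMass_map (φ : G ≃g G) (F : Finset V → ℝ) :
    ∑ T, clusterMass G k a b T * F (T.map φ.toEquiv.toEmbedding) =
      ∑ T, clusterMass G k a b T * F T := by
  rw [← Equiv.sum_comp φ.toEquiv.finsetCongr (fun T => clusterMass G k a b T * F T)]
  refine Finset.sum_congr rfl fun T _ => ?_
  rw [Equiv.finsetCongr_apply, clusterMass, clusterMass, clusterWeight_map]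

/-- Substitution of `σ = 2 * 1_T - 1` into the energy, where `T` is the set of positive vertices:
on a `k`-regular graph the energy is, up to a constant, the logarithm of the weight. -/
theorem energy_eq (hk : ∀ x, G.degree x = k) (σ : V → ℤˣ) :
    energy G a b σ = (b * G.edgeFinset.card - a * Fintype.card V) +
      (2 * a * (plusSet σ).card -
        2 * b * (k * (plusSet σ).card - 2 * (innerEdges G (plusSet σ) : ℝ))) := by
  set t : V → ℝ := fun x => if x ∈ plusSet σ then 1 else 0 with ht
  have hs : ∀ x, ((σ x : ℤ) : ℝ) = 2 * t x - 1 := by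
    intro x
    by_cases h : σ x = 1
    · simp [ht, mem_plusSet, h]
      norm_num
    · simp [ht, mem_plusSet, units_int_ne_one.1 h]
  have hcard : ∑ x, t x = (plusSet σ).card := by simp [ht]
  have hinner : ∑ x, ∑ y, (if G.Adj x y then t x * t y else 0) =
      2 * (innerEdges G (plusSet σ) : ℝ) := by
    rw [two_mul_innerEdges, ← Finset.sum_subset (Finset.subset_univ (plusSet σ))]
    · refine Finset.sum_congr rfl fun x hx => ?_
      rw [← Finset.sum_subset (Finset.subset_univ (plusSet σ))]
      · refine Finset.sum_congr rfl fun y hy => ?_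
        simp [ht, hx, hy]
      · intro y _ hy
        simp [ht, hy]
    · intro x _ hx
      simp [ht, hx]
  have hdeg : ∀ x, ∑ y, (if G.Adj x y then (1 : ℝ) else 0) = k := by
    intro x
    rw [Finset.sum_boole, ← hk x, ← SimpleGraph.card_neighborFinset_eq_degree]
    congr 2
    ext y
    simp
  have hleft : ∑ x, ∑ y, (if G.Adj x y then t x else 0) = k * (plusSet σ).card := by
    rw [← hcard, Finset.mul_sum]
    refine Finset.sum_congr rfl fun x _ => ?_
    rw [← hdeg x, Finset.sum_mul]
    refine Finset.sum_congr rfl fun y _ => ?_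
    split_ifs <;> simp
  have hright : ∑ x, ∑ y, (if G.Adj x y then t y else 0) = k * (plusSet σ).card := by
    rw [Finset.sum_comm, ← hleft]
    refine Finset.sum_congr rfl fun x _ => Finset.sum_congr rfl fun y _ => ?_
    simp only [G.adj_comm y x]
  have hedges := two_mul_sum_edgeFinset G (fun _ => (1 : ℝ))
  rw [Finset.sum_const, nsmul_eq_mul, mul_one] at hedges
  have hsum := two_mul_sum_edgeFinset G
    (fun e => (Sym2.map (fun x => ((σ x : ℤ) : ℝ)) e).mul)
  have hprod : ∑ x, ∑ y, (if G.Adj x y then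
      (Sym2.map (fun x => ((σ x : ℤ) : ℝ)) s(x, y)).mul else 0) =
      4 * ∑ x, ∑ y, (if G.Adj x y then t x * t y else 0) -
      2 * ∑ x, ∑ y, (if G.Adj x y then t x else 0) -
      2 * ∑ x, ∑ y, (if G.Adj x y then t y else 0) +
      ∑ x, ∑ y, (if G.Adj x y then (1 : ℝ) else 0) := by
    simp only [Finset.mul_sum, ← Finset.sum_sub_distrib, ← Finset.sum_add_distrib]
    refine Finset.sum_congr rfl fun x _ => Finset.sum_congr rfl fun y _ => ?_
    split_ifs
    · simp only [Sym2.map_mk, Sym2.mul_mk, hs]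
      ring
    · simp
  rw [hprod, hinner, hleft, hright, ← hedges] at hsum
  rw [energy]
  simp only [hs, Finset.sum_sub_distrib, ← Finset.mul_sum, hcard] at hsum ⊢
  rw [Finset.sum_const, Finset.card_univ, nsmul_eq_mul, mul_one]
  linear_combination b / 2 * hsum

theorem ising_apply_toReal (hk : ∀ x, G.degree x = k) (σ : V → ℤˣ) :
    (ising G a b σ).toReal = clusterMass G k a b (plusSet σ) := by
  have h : ∀ τ : V → ℤˣ, Real.exp (energy G a b τ) =
      Real.exp (b * G.edgeFinset.card - a * Fintype.card V) *
        clusterWeight G k a b (plusSet τ) := by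
    intro τ
    rw [energy_eq hk, Real.exp_add, clusterWeight]
  rw [ising, PMF.ofFintype_apply,
    ENNReal.toReal_ofReal (div_nonneg (Real.exp_pos _).le (partitionFn_pos G a b).le), partitionFn]
  simp only [h]
  rw [← Finset.mul_sum, mul_div_mul_left _ _ (Real.exp_pos _).ne', clusterMass,
    ← Equiv.sum_comp (configEquiv V)]
  rfl

theorem ising_toOuterMeasure_toReal (hk : ∀ x, G.degree x = k) (s : Set (V → ℤˣ)) :
    ((ising G a b).toOuterMeasure s).toReal =
      ∑ T : Finset V, clusterMass G k a b T * s.indicator 1 (configOf T) := by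
  rw [PMF.toOuterMeasure_apply_fintype, ENNReal.toReal_sum, ← Equiv.sum_comp (configEquiv V)]
  · refine Finset.sum_congr rfl fun σ _ => ?_
    have h1 : configOf (configEquiv V σ) = σ := (configEquiv V).left_inv σ
    have h2 : configEquiv V σ = plusSet σ := rfl
    rw [h1, h2, ← ising_apply_toReal hk]
    by_cases h : σ ∈ s <;> simp [h]
  · intro σ _
    by_cases h : σ ∈ s <;> simp [h, PMF.apply_ne_top]

/-- The Markov property: given that the boundary of `U` is negative, the configuration on `U` is
independent of the configuration outside `U`, and has probability proportional to its weight. -/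
theorem sum_clusterMass_eq_of_boundary [DecidableEq V] {U P : Finset V} (hP : P ⊆ U)
    {F : Finset V → ℝ} (hF : ∀ T, F T = F (T \ U)) :
    (∑ R ∈ U.powerset, clusterWeight G k a b R) *
      ∑ T with T ∩ U = P ∧ Disjoint T (boundary G U), clusterMass G k a b T * F T =
    clusterWeight G k a b P *
      ∑ T with Disjoint T (boundary G U), clusterMass G k a b T * F T := by
  have hnb : ∀ T : Finset V, Disjoint T (boundary G U) →
      clusterWeight G k a b T = clusterWeight G k a b (T ∩ U) * clusterWeight G k a b (T \ U) := by
    intro T hT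
    rw [← clusterWeight_union]
    · rw [Finset.union_comm, Finset.sdiff_union_inter]
    · exact (Finset.disjoint_sdiff_inter T U).symm
    · intro x hx y hy hxy
      rw [Finset.mem_inter] at hx
      rw [Finset.mem_sdiff] at hy
      refine Finset.disjoint_left.1 hT hy.1 ?_
      simp only [boundary, Finset.mem_filter, Finset.mem_univ, true_and]
      exact ⟨hy.2, x, hx.2, hxy⟩
  have hbU : Disjoint U (boundary G U) := by
    rw [Finset.disjoint_left]
    intro x hx hx'
    simp only [boundary, Finset.mem_filter] at hx'
    exact hx'.2.1 hx
  set Z := ∑ T : Finset V, clusterWeight G k a b T with hZ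
  -- The sum over the configurations outside `U`, the configuration on `U` being fixed
  set A := ∑ T' with Disjoint T' U ∧ Disjoint T' (boundary G U),
    clusterWeight G k a b T' / Z * F T' with hA
  have key : ∀ R ⊆ U, ∑ T with T ∩ U = R ∧ Disjoint T (boundary G U),
      clusterMass G k a b T * F T = clusterWeight G k a b R * A := by
    intro R hR
    rw [hA, Finset.mul_sum]
    refine Finset.sum_bij' (fun T _ => T \ U) (fun T' _ => T' ∪ R) ?_ ?_ ?_ ?_ ?_
    · intro T hT
      simp only [Finset.mem_filter, Finset.mem_univ, true_and] at hT ⊢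
      exact ⟨Finset.sdiff_disjoint, hT.2.mono_left Finset.sdiff_subset⟩
    · intro T' hT'
      simp only [Finset.mem_filter, Finset.mem_univ, true_and] at hT' ⊢
      refine ⟨?_, Finset.disjoint_union_left.2 ⟨hT'.2, hbU.mono_left hR⟩⟩
      rw [Finset.union_inter_distrib_right, Finset.disjoint_iff_inter_eq_empty.1 hT'.1,
        Finset.empty_union, Finset.inter_eq_left.2 hR]
    · intro T hT
      simp only [Finset.mem_filter, Finset.mem_univ, true_and] at hT
      rw [← hT.1, Finset.sdiff_union_inter]
    · intro T' hT'
      simp only [Finset.mem_filter, Finset.mem_univ, true_and] at hT'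
      rw [Finset.union_sdiff_distrib, Finset.sdiff_eq_empty_iff_subset.2 hR, Finset.union_empty,
        Finset.sdiff_eq_self_of_disjoint hT'.1]
    · intro T hT
      simp only [Finset.mem_filter, Finset.mem_univ, true_and] at hT
      rw [clusterMass, hnb T hT.2, hT.1, hF T]
      ring
  have htot : ∑ T with Disjoint T (boundary G U), clusterMass G k a b T * F T =
      (∑ R ∈ U.powerset, clusterWeight G k a b R) * A := by
    rw [← Finset.sum_fiberwise_of_maps_to (t := U.powerset) (g := fun T => T ∩ U)
      (fun T _ => by simp), Finset.sum_mul]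
    refine Finset.sum_congr rfl fun R hR => ?_
    rw [← key R (Finset.mem_powerset.1 hR), Finset.filter_filter]
    refine Finset.sum_congr ?_ fun _ _ => rfl
    ext T
    simp [and_comm]
  rw [htot, key P hP]
  ring

end Cluster

/-! ### Geometry of the torus -/

section TorusGeometry

open scoped Classical

variable {d : ℕ} {p : ℝ≥0∞} {ρ : ℝ} {n : ℕ+}

/-- All coordinates of `x`, measured modulo `n`, are at most `M` in absolute value. -/
def InBox (M : ℝ) (x : Torus d n) : Prop := ∀ i, |((x i).valMinAbs : ℝ)| ≤ M

theorem InBox.mono {M M' : ℝ} (h : M ≤ M') {x : Torus d n} (hx : InBox M x) : InBox M' x :=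
  fun i => (hx i).trans h

theorem inBox_zero {M : ℝ} (h : 0 ≤ M) : InBox M (0 : Torus d n) := fun i => by simpa using h

theorem InBox.neg {M : ℝ} {x : Torus d n} (hx : InBox M x) : InBox M (-x) := by
  intro i
  rw [← Int.cast_abs, Int.abs_eq_natAbs, Pi.neg_apply, ZMod.natAbs_valMinAbs_neg,
    ← Int.abs_eq_natAbs, Int.cast_abs]
  exact hx i

theorem InBox.add {M M' : ℝ} {x y : Torus d n} (hx : InBox M x) (hy : InBox M' y) :
    InBox (M + M') (x + y) := by
  intro i
  have h1 : |(x i + y i).valMinAbs| ≤ |(x i).valMinAbs + (y i).valMinAbs| := by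
    rw [Int.abs_eq_natAbs, Int.abs_eq_natAbs]
    exact_mod_cast ZMod.natAbs_valMinAbs_add_le (x i) (y i)
  have h2 : |((x i + y i).valMinAbs : ℝ)| ≤ |((x i).valMinAbs : ℝ) + ((y i).valMinAbs : ℝ)| := by
    exact_mod_cast h1
  exact h2.trans ((abs_add_le _ _).trans (add_le_add (hx i) (hy i)))

theorem InBox.sub {M M' : ℝ} {x y : Torus d n} (hx : InBox M x) (hy : InBox M' y) :
    InBox (M + M') (x - y) := by
  rw [sub_eq_add_neg]
  exact hx.add hy.neg

/-- There is no wrapping around the torus for small coordinates. -/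
theorem valMinAbs_add_of_lt {m : ℕ} [NeZero m] {x y : ZMod m} {M M' : ℝ}
    (hx : |(x.valMinAbs : ℝ)| ≤ M) (hy : |(y.valMinAbs : ℝ)| ≤ M') (h : 2 * (M + M') < m) :
    (x + y).valMinAbs = x.valMinAbs + y.valMinAbs := by
  rw [ZMod.valMinAbs_spec]
  refine ⟨by push_cast; simp, ?_⟩
  rw [abs_le] at hx hy
  constructor
  · have : (-(m : ℝ)) < ((x.valMinAbs : ℝ) + y.valMinAbs) * 2 := by linarith
    exact_mod_cast this
  · have : ((x.valMinAbs : ℝ) + y.valMinAbs) * 2 ≤ m := by linarith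
    exact_mod_cast this

/-- A nonempty set of small diameter is not invariant under a small translation: a point that is
extremal in a direction in which the translation moves leaves the set. -/
theorem exists_add_notMem {P : Finset (Torus d n)} (hP : P.Nonempty) {x v : Torus d n} (hv : v ≠ 0)
    {M M' : ℝ} (hPM : ∀ u ∈ P, InBox M (u - x)) (hvM : InBox M' v)
    (hn : 2 * (M + M') < ((n : ℕ) : ℝ)) : ∃ u ∈ P, u + v ∉ P := by
  obtain ⟨i, hi⟩ : ∃ i, v i ≠ 0 := by
    by_contra! h
    exact hv (funext h)
  have hi' : (v i).valMinAbs ≠ 0 := by rwa [Ne, ZMod.valMinAbs_eq_zero]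
  have hadd : ∀ u ∈ P, ((u + v - x) i).valMinAbs = ((u - x) i).valMinAbs + (v i).valMinAbs := by
    intro u hu
    rw [← valMinAbs_add_of_lt (hPM u hu i) (hvM i) hn]
    congr 1
    simp only [Pi.add_apply, Pi.sub_apply]
    ring
  by_contra! h
  rcases lt_or_gt_of_ne hi' with hneg | hpos
  · obtain ⟨u, hu, hmin⟩ := P.exists_min_image (fun u => ((u - x) i).valMinAbs) hP
    have := hmin (u + v) (h u hu)
    rw [hadd u hu] at this
    omega
  · obtain ⟨u, hu, hmax⟩ := P.exists_max_image (fun u => ((u - x) i).valMinAbs) hP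
    have := hmax (u + v) (h u hu)
    rw [hadd u hu] at this
    omega

theorem inBox_of_torusNorm_le (hp : 1 ≤ p) {x : Torus d n} (h : torusNorm p x ≤ ρ) :
    InBox ρ x := by
  have : Fact (1 ≤ p) := ⟨hp⟩
  intro i
  refine le_trans ?_ h
  have := PiLp.norm_apply_le
    (WithLp.toLp p (fun i => (((x i).valMinAbs.natAbs : ℕ) : ℝ)) : PiLp p (fun _ : Fin d => ℝ)) i
  refine le_trans (le_of_eq ?_) this
  simp only [Real.norm_eq_abs, Nat.abs_cast]
  rw [← Int.cast_abs, Int.abs_eq_natAbs]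
  simp

theorem torusGraph_adj {x y : Torus d n} :
    (torusGraph d p ρ n).Adj x y ↔ x ≠ y ∧ torusNorm p (y - x) ≤ ρ := Iff.rfl

/-- Translations are automorphisms of `G_n`. -/
def translation (d : ℕ) (p : ℝ≥0∞) (ρ : ℝ) (n : ℕ+) (z : Torus d n) :
    torusGraph d p ρ n ≃g torusGraph d p ρ n where
  toEquiv := Equiv.addRight z
  map_rel_iff' := by
    intro x y
    simp [torusGraph_adj]

theorem translation_apply (z x : Torus d n) : translation d p ρ n z x = x + z := rfl

theorem degree_torusGraph (x : Torus d n) :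
    (torusGraph d p ρ n).degree x = torusDegree d p ρ n := by
  rw [torusDegree, ← (translation d p ρ n x).degree_eq 0, translation_apply, zero_add]

theorem edist_add_right_le (x y z : Torus d n) :
    (torusGraph d p ρ n).edist (x + z) (y + z) ≤ (torusGraph d p ρ n).edist x y := by
  rcases eq_or_ne ((torusGraph d p ρ n).edist x y) ⊤ with h | h
  · rw [h]
    exact le_top
  · obtain ⟨w, hw⟩ := SimpleGraph.exists_walk_of_edist_ne_top h
    rw [← hw]
    have := SimpleGraph.edist_le (w.map (translation d p ρ n z).toHom)
    rw [SimpleGraph.Walk.length_map] at this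
    exact this

theorem edist_add_right (x y z : Torus d n) :
    (torusGraph d p ρ n).edist (x + z) (y + z) = (torusGraph d p ρ n).edist x y := by
  refine le_antisymm (edist_add_right_le x y z) ?_
  simpa using edist_add_right_le (p := p) (ρ := ρ) (x + z) (y + z) (-z)

theorem mem_ball {x v : Torus d n} {r : ℕ} :
    v ∈ ball (torusGraph d p ρ n) x r ↔ v - x ∈ ball (torusGraph d p ρ n) 0 r := by
  have := edist_add_right (p := p) (ρ := ρ) 0 (v - x) x
  rw [zero_add, sub_add_cancel] at this
  simp [ball, this]

theorem mem_boundary_ball {x v : Torus d n} {r : ℕ} :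
    v ∈ boundary (torusGraph d p ρ n) (ball (torusGraph d p ρ n) x r) ↔
      v - x ∈ boundary (torusGraph d p ρ n) (ball (torusGraph d p ρ n) 0 r) := by
  have hadj : ∀ u, (torusGraph d p ρ n).Adj (u - x) (v - x) ↔ (torusGraph d p ρ n).Adj u v := by
    intro u
    simp [torusGraph_adj]
  simp only [boundary, Finset.mem_filter, Finset.mem_univ, true_and]
  rw [mem_ball]
  refine and_congr_right fun _ => ⟨?_, ?_⟩
  · rintro ⟨u, hu, huv⟩
    exact ⟨u - x, mem_ball.1 hu, (hadj u).2 huv⟩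
  · rintro ⟨u, hu, huv⟩
    refine ⟨u + x, ?_, ?_⟩
    · rw [mem_ball]
      simpa using hu
    · rw [← hadj]
      simpa using huv

theorem inBox_of_mem_ball (hp : 1 ≤ p) (hρ : 0 ≤ ρ) {v : Torus d n} {r : ℕ}
    (hv : v ∈ ball (torusGraph d p ρ n) 0 r) : InBox (ρ * r) v := by
  have hwalk : ∀ x y : Torus d n, ∀ w : (torusGraph d p ρ n).Walk x y,
      InBox (ρ * w.length) (y - x) := by
    intro x y w
    induction w with
    | nil => simpa using inBox_zero le_rfl
    | @cons u v w h q ih =>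
      have := ih.add (inBox_of_torusNorm_le hp h.2)
      rw [sub_add_sub_cancel] at this
      refine this.mono (le_of_eq ?_)
      rw [SimpleGraph.Walk.length_cons]
      push_cast
      ring
  simp only [ball, Finset.mem_filter, Finset.mem_univ, true_and] at hv
  obtain ⟨w, hw⟩ := SimpleGraph.exists_walk_of_edist_ne_top
    (ne_top_of_le_ne_top (ENat.natCast_ne_top r) hv)
  rw [← hw] at hv
  have h2 : w.length ≤ r := by exact_mod_cast hv
  have := hwalk 0 v w
  rw [sub_zero] at this
  refine this.mono (mul_le_mul_of_nonneg_left ?_ hρ)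
  exact_mod_cast h2

theorem inBox_of_mem_boundary_ball (hp : 1 ≤ p) (hρ : 0 ≤ ρ) {v : Torus d n} {r : ℕ}
    (hv : v ∈ boundary (torusGraph d p ρ n) (ball (torusGraph d p ρ n) 0 r)) :
    InBox (ρ * (r + 1)) v := by
  simp only [boundary, Finset.mem_filter, Finset.mem_univ, true_and] at hv
  obtain ⟨-, u, hu, huv⟩ := hv
  have := (inBox_of_mem_ball hp hρ hu).add (inBox_of_torusNorm_le hp huv.2)
  rw [add_sub_cancel] at this
  exact this.mono (by linarith)

theorem boundary_ball_nonempty (hd : 1 ≤ d) (hp : 1 ≤ p) (hρ : 1 ≤ ρ) {r : ℕ}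
    (hn : 2 * ρ * ((r : ℝ) + 1) < ((n : ℕ) : ℝ)) :
    (boundary (torusGraph d p ρ n) (ball (torusGraph d p ρ n) 0 r)).Nonempty := by
  have hn2 : 2 ≤ (n : ℕ) := by
    have h0 : (0 : ℝ) ≤ r := Nat.cast_nonneg r
    have : (2 : ℝ) ≤ ((n : ℕ) : ℝ) := by nlinarith
    exact_mod_cast this
  have : Fact (1 ≤ p) := ⟨hp⟩
  have : Fact (1 < (n : ℕ)) := ⟨by omega⟩
  have h1 : (1 : ZMod (n : ℕ)).valMinAbs = 1 := by
    have := ZMod.valMinAbs_natCast_of_le_half (n := n) (a := 1) (by omega)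
    simpa using this
  set i₀ : Fin d := ⟨0, hd⟩
  set v : Torus d n := Pi.single i₀ 1 with hv
  have hv0 : v ≠ 0 := by
    intro h
    have := congrFun h i₀
    simp [hv] at this
  have hvn : torusNorm p v ≤ ρ := by
    have h2 : (WithLp.toLp p (fun i => (((v i).valMinAbs.natAbs : ℕ) : ℝ)) :
        PiLp p (fun _ : Fin d => ℝ)) = PiLp.single p i₀ (1 : ℝ) := by
      ext i
      rcases eq_or_ne i i₀ with rfl | hi
      · simp [hv, h1]
      · simp [hv, hi]
    rw [torusNorm, h2]
    refine le_trans (le_of_eq ?_) hρ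
    exact (PiLp.norm_single p (fun _ : Fin d => ℝ) i₀ (1 : ℝ)).trans (by simp)
  have hball0 : (0 : Torus d n) ∈ ball (torusGraph d p ρ n) 0 r := by simp [ball]
  obtain ⟨u, hu, huv⟩ := exists_add_notMem (x := 0) ⟨0, hball0⟩ hv0
    (fun u hu => by
      rw [sub_zero]
      exact inBox_of_mem_ball hp (by linarith) hu)
    (inBox_of_torusNorm_le hp hvn) (by linarith)
  refine ⟨u + v, ?_⟩
  simp only [boundary, Finset.mem_filter, Finset.mem_univ, true_and]
  refine ⟨huv, u, hu, ?_, ?_⟩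
  · simpa using hv0
  · simpa using hvn

/-- Isoperimetry: for each of the vectors `v` joining `0` to its neighbors, some `u ∈ P` has its
neighbor `u + v` outside `P`, so the perimeter of `P` is at least the degree. -/
theorem torusDegree_le_perimeter (hp : 1 ≤ p) {P : Finset (Torus d n)} (hP : P.Nonempty)
    {x : Torus d n} {M : ℝ} (hPM : ∀ u ∈ P, InBox M (u - x))
    (hn : 2 * (M + ρ) < ((n : ℕ) : ℝ)) :
    (torusDegree d p ρ n : ℝ) ≤
      torusDegree d p ρ n * P.card - 2 * innerEdges (torusGraph d p ρ n) P := by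
  set G := torusGraph d p ρ n
  have hsum : ∑ x ∈ P, ∑ y ∈ P, (if G.Adj x y then (1 : ℝ) else 0) =
      ∑ v ∈ G.neighborFinset 0, ((P.filter fun u => u + v ∈ P).card : ℝ) := by
    have h1 : ∀ u ∈ P, ∑ y ∈ P, (if G.Adj u y then (1 : ℝ) else 0) =
        ∑ v ∈ G.neighborFinset 0, if u + v ∈ P then (1 : ℝ) else 0 := by
      intro u _
      rw [Finset.sum_boole, Finset.sum_boole]
      congr 1
      refine Finset.card_bij' (fun y _ => y - u) (fun v _ => u + v) ?_ ?_ ?_ ?_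
      · intro y hy
        rw [Finset.mem_filter] at hy ⊢
        rw [SimpleGraph.mem_neighborFinset]
        refine ⟨⟨?_, ?_⟩, ?_⟩
        · exact (sub_ne_zero.2 hy.2.1.symm).symm
        · simpa using hy.2.2
        · simpa using hy.1
      · intro v hv
        rw [Finset.mem_filter, SimpleGraph.mem_neighborFinset] at hv
        rw [Finset.mem_filter]
        refine ⟨hv.2, ?_, ?_⟩
        · simpa using hv.1.1.symm
        · simpa using hv.1.2
      · intro y _
        simp
      · intro v _
        simp
    rw [Finset.sum_congr rfl h1, Finset.sum_comm]
    refine Finset.sum_congr rfl fun v _ => ?_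
    rw [Finset.sum_boole]
  have hle : ∀ v ∈ G.neighborFinset 0,
      ((P.filter fun u => u + v ∈ P).card : ℝ) ≤ (P.card : ℝ) - 1 := by
    intro v hv
    rw [SimpleGraph.mem_neighborFinset] at hv
    obtain ⟨u, hu, huv⟩ := exists_add_notMem hP hv.1.symm hPM
      (inBox_of_torusNorm_le hp (by simpa using hv.2)) hn
    have : (P.filter fun u => u + v ∈ P).card < P.card :=
      Finset.card_lt_card (Finset.filter_ssubset.2 ⟨u, hu, huv⟩)
    have : ((P.filter fun u => u + v ∈ P).card : ℝ) + 1 ≤ P.card := by exact_mod_cast this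
    linarith
  have hdeg : (torusDegree d p ρ n : ℝ) = (G.neighborFinset 0).card := by
    rw [torusDegree, ← SimpleGraph.card_neighborFinset_eq_degree]
  rw [two_mul_innerEdges, hsum, hdeg]
  have := Finset.sum_le_sum hle
  rw [Finset.sum_const, nsmul_eq_mul] at this
  linarith

/-- The box `[-M, M]^d` of the lattice; its cardinality bounds, uniformly in `n`, the sizes of the
balls, boundaries and neighborhoods in the torus that lie in a translate of its image. -/
def intBox (d M : ℕ) : Finset (Fin d → ℤ) := Fintype.piFinset fun _ => Finset.Icc (-(M : ℤ)) M

theorem exists_mem_intBox {M : ℕ} {x : Torus d n} (hx : InBox M x) :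
    ∃ v ∈ intBox d M, (fun i => ((v i : ℤ) : ZMod (n : ℕ))) = x := by
  refine ⟨fun i => (x i).valMinAbs, ?_, ?_⟩
  · simp only [intBox, Fintype.mem_piFinset, Finset.mem_Icc]
    intro i
    have := hx i
    rw [← Int.cast_abs] at this
    have : |(x i).valMinAbs| ≤ (M : ℤ) := by exact_mod_cast this
    exact abs_le.1 this
  · funext i
    exact ZMod.coe_valMinAbs _

theorem card_le_of_inBox {M : ℕ} {P : Finset (Torus d n)} {x : Torus d n}
    (h : ∀ u ∈ P, InBox M (u - x)) : P.card ≤ (intBox d M).card := by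
  refine Finset.card_le_card_of_surjOn
    (fun v => (fun i => ((v i : ℤ) : ZMod (n : ℕ))) + x) ?_
  intro u hu
  obtain ⟨v, hv, hvu⟩ := exists_mem_intBox (h u hu)
  exact ⟨v, hv, by simp [hvu]⟩

end TorusGeometry

/-! ### Occurrences of the pattern in terms of sets of positive vertices -/

section Pattern

open scoped Classical

variable {d : ℕ} {p : ℝ≥0∞} {ρ : ℝ} {n : ℕ+} {η : (Fin d → ℤ) → ℤˣ} {r : ℕ} {a b : ℝ}

theorem mem_posSet {V : Type*} {U : Finset V} {ζ : U → ℤˣ} {v : V} :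
    v ∈ posSet ζ ↔ ∃ h : v ∈ U, ζ ⟨v, h⟩ = 1 := by
  simp [posSet]

theorem mem_posSet_glue {V : Type*} {U U' : Finset V} (hd : Disjoint U U') {ζ : U → ℤˣ}
    {σ : U' → ℤˣ} {v : V} : v ∈ posSet (glue ζ σ) ↔ v ∈ posSet ζ ∨ v ∈ posSet σ := by
  simp only [mem_posSet, glue, Finset.mem_union]
  by_cases h : v ∈ U
  · have h' : v ∉ U' := Finset.disjoint_left.1 hd h
    simp [h, h']
  · simp [h]

/-- A configuration agrees on `U` with `ζ` iff its positive vertices in `U` are those of `ζ`. -/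
theorem restrict_configOf_eq_iff {V : Type*} [Fintype V] [DecidableEq V] {U : Finset V}
    {ζ : U → ℤˣ} {T : Finset V} :
    (fun v : U => configOf T v) = ζ ↔ T ∩ U = posSet ζ := by
  have h1 : ∀ v : V, configOf T v = 1 ↔ v ∈ T := by
    intro v
    by_cases h : v ∈ T <;> simp [configOf, h]
  constructor
  · rintro rfl
    ext v
    simp [mem_posSet, h1, and_comm]
  · intro h
    funext v
    refine eq_of_eq_one_iff ?_
    rw [h1]
    have := Finset.ext_iff.1 h v
    simpa [mem_posSet] using this

/-- The set of positive vertices of `η_x`. -/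
def pattern (p : ℝ≥0∞) (ρ : ℝ) (n : ℕ+) (η : (Fin d → ℤ) → ℤˣ) (r : ℕ) (x : Torus d n) :
    Finset (Torus d n) := posSet (translate p ρ n η r x)

/-- The ball `B(x, r)` together with its boundary. -/
def window (p : ℝ≥0∞) (ρ : ℝ) (n : ℕ+) (r : ℕ) (x : Torus d n) : Finset (Torus d n) :=
  ball (torusGraph d p ρ n) x r ∪ boundary (torusGraph d p ρ n) (ball (torusGraph d p ρ n) x r)

/-- The event that `η` occurs at `x` with a negative boundary. -/
def isolatedAt (p : ℝ≥0∞) (ρ : ℝ) (n : ℕ+) (η : (Fin d → ℤ) → ℤˣ) (r : ℕ) (x : Torus d n) :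
    Finset (Finset (Torus d n)) :=
  Finset.univ.filter fun T => T ∩ window p ρ n r x = pattern p ρ n η r x

theorem mem_isolatedAt {x : Torus d n} {T : Finset (Torus d n)} :
    T ∈ isolatedAt p ρ n η r x ↔ T ∩ window p ρ n r x = pattern p ρ n η r x := by
  simp [isolatedAt]

theorem pattern_subset_ball {x : Torus d n} :
    pattern p ρ n η r x ⊆ ball (torusGraph d p ρ n) x r := by
  intro v hv
  exact (mem_posSet.1 hv).1

theorem ball_subset_window {x : Torus d n} :
    ball (torusGraph d p ρ n) x r ⊆ window p ρ n r x := Finset.subset_union_left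

theorem pattern_subset_window {x : Torus d n} : pattern p ρ n η r x ⊆ window p ρ n r x :=
  pattern_subset_ball.trans ball_subset_window

theorem mem_pattern {x v : Torus d n} :
    v ∈ pattern p ρ n η r x ↔ v - x ∈ pattern p ρ n η r 0 := by
  simp only [pattern, mem_posSet, translate]
  constructor
  · rintro ⟨h, h'⟩
    exact ⟨mem_ball.1 h, by simpa using h'⟩
  · rintro ⟨h, h'⟩
    exact ⟨mem_ball.2 h, by simpa using h'⟩

theorem disjoint_ball_boundary {x : Torus d n} :
    Disjoint (ball (torusGraph d p ρ n) x r)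
      (boundary (torusGraph d p ρ n) (ball (torusGraph d p ρ n) x r)) := by
  rw [Finset.disjoint_left]
  intro v hv hv'
  simp only [boundary, Finset.mem_filter] at hv'
  exact hv'.2.1 hv

theorem mem_window_of_adj {x u v : Torus d n} (hu : u ∈ ball (torusGraph d p ρ n) x r)
    (h : (torusGraph d p ρ n).Adj u v) : v ∈ window p ρ n r x := by
  by_cases hv : v ∈ ball (torusGraph d p ρ n) x r
  · exact Finset.mem_union_left _ hv
  · refine Finset.mem_union_right _ ?_
    simp only [boundary, Finset.mem_filter, Finset.mem_univ, true_and]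
    exact ⟨hv, u, hu, h⟩

theorem inBox_of_mem_window (hp : 1 ≤ p) (hρ : 0 ≤ ρ) {x v : Torus d n}
    (hv : v ∈ window p ρ n r x) : InBox (ρ * (r + 1)) (v - x) := by
  rcases Finset.mem_union.1 hv with h | h
  · exact (inBox_of_mem_ball hp hρ (mem_ball.1 h)).mono (by nlinarith)
  · exact inBox_of_mem_boundary_ball hp hρ (mem_boundary_ball.1 h)

theorem isolatedAt_iff {x : Torus d n} {T : Finset (Torus d n)} :
    T ∈ isolatedAt p ρ n η r x ↔
      T ∩ ball (torusGraph d p ρ n) x r = pattern p ρ n η r x ∧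
        Disjoint T (boundary (torusGraph d p ρ n) (ball (torusGraph d p ρ n) x r)) := by
  rw [mem_isolatedAt, window, Finset.inter_union_distrib_left]
  constructor
  · intro h
    have h2 : Disjoint T (boundary (torusGraph d p ρ n) (ball (torusGraph d p ρ n) x r)) := by
      rw [Finset.disjoint_left]
      intro v hvT hv
      have : v ∈ pattern p ρ n η r x := by
        rw [← h]
        exact Finset.mem_union_right _ (Finset.mem_inter.2 ⟨hvT, hv⟩)
      exact Finset.disjoint_left.1 disjoint_ball_boundary (pattern_subset_ball this) hv
    rw [Finset.disjoint_iff_inter_eq_empty.1 h2, Finset.union_empty] at h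
    exact ⟨h, h2⟩
  · rintro ⟨h1, h2⟩
    rw [h1, Finset.disjoint_iff_inter_eq_empty.1 h2, Finset.union_empty]

theorem weight_eq_clusterWeight {U : Finset (Torus d n)} (ζ : U → ℤˣ) :
    weight p ρ a b ζ =
      clusterWeight (torusGraph d p ρ n) (torusDegree d p ρ n) a b (posSet ζ) := rfl

theorem clusterWeight_translate {P P' : Finset (Torus d n)} {x : Torus d n} {k : ℕ}
    (h : ∀ v, v ∈ P ↔ v - x ∈ P') :
    clusterWeight (torusGraph d p ρ n) k a b P = clusterWeight (torusGraph d p ρ n) k a b P' := by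
  rw [← clusterWeight_map (translation d p ρ n x) P']
  congr 1
  ext v
  rw [h v, Finset.mem_map_equiv]
  exact Iff.of_eq (congrArg (· ∈ P') (sub_eq_add_neg v x))

theorem clusterWeight_pattern (x : Torus d n) :
    clusterWeight (torusGraph d p ρ n) (torusDegree d p ρ n) a b (pattern p ρ n η r x) =
      localWeight p ρ a b n η r :=
  clusterWeight_translate fun _ => mem_pattern

theorem localWeight_pos : 0 < localWeight p ρ a b n η r := Real.exp_pos _

theorem occurrences_configOf (T : Finset (Torus d n)) :
    occurrences p ρ n η r (configOf T) = ∑ x : Torus d n,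
      if T ∩ ball (torusGraph d p ρ n) x r = pattern p ρ n η r x then 1 else 0 := by
  unfold occurrences
  refine Finset.sum_congr rfl fun x _ => ?_
  exact if_congr restrict_configOf_eq_iff rfl rfl

/-! ### Bounds on the weights -/

theorem bddAbove_range_of_finite {ι : Type*} [Finite ι] (f : ι → ℝ) :
    BddAbove (Set.range f) := (Set.finite_range f).bddAbove

/-- The definition of `Δ_n(η)` in terms of positive vertices, for the ball around any `x`. -/
theorem clusterWeight_pattern_union_le {x : Torus d n} {S : Finset (Torus d n)} (hS : S.Nonempty)
    (hSb : S ⊆ boundary (torusGraph d p ρ n) (ball (torusGraph d p ρ n) x r)) :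
    clusterWeight (torusGraph d p ρ n) (torusDegree d p ρ n) a b (pattern p ρ n η r x ∪ S) ≤
      probGap p ρ a b n η r * localWeight p ρ a b n η r := by
  set δ := boundary (torusGraph d p ρ n) (ball (torusGraph d p ρ n) 0 r) with hδ
  set σ : δ → ℤˣ := fun v => if (v : Torus d n) + x ∈ S then 1 else -1 with hσ
  obtain ⟨z, hz⟩ := hS
  have hzδ : z - x ∈ δ := mem_boundary_ball.1 (hSb hz)
  have hσ1 : σ ≠ fun _ => -1 := by
    intro h
    have := congrFun h ⟨z - x, hzδ⟩
    simp [hσ, hz] at this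
  have hle : weight p ρ a b (glue (translate p ρ n η r 0) σ) / localWeight p ρ a b n η r ≤
      probGap p ρ a b n η r :=
    le_ciSup (bddAbove_range_of_finite (fun σ : {σ : δ → ℤˣ // σ ≠ fun _ => -1} =>
      weight p ρ a b (glue (translate p ρ n η r 0) σ.1) / localWeight p ρ a b n η r)) ⟨σ, hσ1⟩
  rw [div_le_iff₀ localWeight_pos] at hle
  refine le_trans (le_of_eq ?_) hle
  rw [weight_eq_clusterWeight]
  refine clusterWeight_translate (x := x) fun v => ?_
  rw [mem_posSet_glue disjoint_ball_boundary, Finset.mem_union, mem_pattern, mem_posSet (ζ := σ)]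
  refine or_congr Iff.rfl ⟨fun h => ⟨mem_boundary_ball.1 (hSb h), by simp [hσ, h]⟩, ?_⟩
  rintro ⟨_, h⟩
  by_contra hvS
  simp [hσ, hvS] at h

/-- The weight of a single positive vertex, as a lower bound of `Δ_n(η)`. -/
theorem exp_le_probGap (hd : 1 ≤ d) (hp : 1 ≤ p) (hρ : 1 ≤ ρ) (hb : 0 ≤ b)
    (hn : 2 * ρ * ((r : ℝ) + 1) < ((n : ℕ) : ℝ)) :
    Real.exp (2 * a - 2 * b * torusDegree d p ρ n) ≤ probGap p ρ a b n η r := by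
  obtain ⟨z, hz⟩ := boundary_ball_nonempty hd hp hρ hn
  have h1 := clusterWeight_pattern_union_le (a := a) (b := b) (η := η)
    (Finset.singleton_nonempty z) (Finset.singleton_subset_iff.2 hz)
  have hzp : z ∉ pattern p ρ n η r 0 := fun h =>
    Finset.disjoint_left.1 disjoint_ball_boundary (pattern_subset_ball h) hz
  have h2 := le_clusterWeight_insert (G := torusGraph d p ρ n) (k := torusDegree d p ρ n)
    (a := a) hb hzp
  rw [clusterWeight_pattern] at h2
  rw [Finset.union_comm, ← Finset.insert_eq] at h1
  have h3 := h2.trans h1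
  rw [mul_comm] at h3
  exact le_of_mul_le_mul_right h3 localWeight_pos

theorem clusterWeight_le_exp (hp : 1 ≤ p) (ha : a ≤ 0) (hb : 0 ≤ b) {P : Finset (Torus d n)}
    (hP : P.Nonempty) {x : Torus d n} {M : ℝ} (hPM : ∀ u ∈ P, InBox M (u - x))
    (hn : 2 * (M + ρ) < ((n : ℕ) : ℝ)) :
    clusterWeight (torusGraph d p ρ n) (torusDegree d p ρ n) a b P ≤
      Real.exp (2 * a - 2 * b * torusDegree d p ρ n) :=
  clusterWeight_le_of_perimeter ha hb hP (torusDegree_le_perimeter hp hP hPM hn)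

/-! ### Bounds on the probabilities -/

theorem sum_le_sum_of_cover {ι α : Type*} {m : α → ℝ} (hm : ∀ T, 0 ≤ m T) {s : Finset α}
    {I : Finset ι} {t : ι → Finset α} (h : ∀ T ∈ s, ∃ i ∈ I, T ∈ t i) :
    ∑ T ∈ s, m T ≤ ∑ i ∈ I, ∑ T ∈ t i, m T := by
  calc ∑ T ∈ s, m T ≤ ∑ T ∈ s, ∑ i ∈ I, if T ∈ t i then m T else 0 := by
        refine Finset.sum_le_sum fun T hT => ?_
        obtain ⟨i, hi, hTi⟩ := h T hT
        refine le_trans (le_of_eq (if_pos hTi).symm) (Finset.single_le_sum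
          (f := fun i => if T ∈ t i then m T else 0) (fun j _ => ?_) hi)
        split_ifs
        exacts [hm T, le_rfl]
    _ = ∑ i ∈ I, ∑ T ∈ s with T ∈ t i, m T := by
        rw [Finset.sum_comm]
        exact Finset.sum_congr rfl fun i _ => (Finset.sum_filter _ _).symm
    _ ≤ ∑ i ∈ I, ∑ T ∈ t i, m T := Finset.sum_le_sum fun i _ =>
        Finset.sum_le_sum_of_subset_of_nonneg
          (fun T hT => (Finset.mem_filter.1 hT).2) fun _ _ _ => hm _

/-- The bound `μ(T ∩ U = P) ≤ C W(P)`, for all `P ⊆ U` with `U` in a translate of `[-M, M]^d`. -/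
def MarginalBound (p : ℝ≥0∞) (ρ a b : ℝ) (d : ℕ) (n : ℕ+) (M : ℕ) (C : ℝ) : Prop :=
  ∀ (x : Torus d n) (U P : Finset (Torus d n)), P ⊆ U → (∀ u ∈ U, InBox M (u - x)) →
    ∑ T with T ∩ U = P, clusterMass (torusGraph d p ρ n) (torusDegree d p ρ n) a b T ≤
      C * clusterWeight (torusGraph d p ρ n) (torusDegree d p ρ n) a b P

/-- Since a box has finitely many subsets, the sizes from which on hypothesis (H2) applies to them
have a common bound; the translates of the box are covered by translation invariance. -/
theorem exists_marginalBound {a b : ℕ+ → ℝ} (H2 : HypWeight d p ρ a b) (M : ℕ) :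
    ∃ C : ℝ, 0 < C ∧ ∃ N : ℕ+, ∀ n : ℕ+, N ≤ n → MarginalBound p ρ (a n) (b n) d n M C := by
  obtain ⟨C₀, hC₀, hV⟩ := H2
  choose Nf hNf using hV
  obtain ⟨N, hN⟩ := ((intBox d M).powerset.image Nf).exists_le
  set C : ℝ := ∑ j ∈ Finset.range ((intBox d M).card + 1), C₀ j with hC
  have hCle : ∀ V ⊆ intBox d M, C₀ V.card ≤ C := fun V hVM =>
    Finset.single_le_sum (f := C₀) (fun j _ => (hC₀ j).le)
      (Finset.mem_range.2 (Nat.lt_succ_of_le (Finset.card_le_card hVM)))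
  refine ⟨C, (hC₀ 0).trans_le (by simpa using hCle ∅ (Finset.empty_subset _)), N, ?_⟩
  intro n hn
  set G := torusGraph d p ρ n
  set k := torusDegree d p ρ n
  have key : ∀ V ⊆ intBox d M, ∀ P ⊆ reduceSet n V,
      ∑ T with T ∩ reduceSet n V = P, clusterMass G k (a n) (b n) T ≤
        C₀ V.card * clusterWeight G k (a n) (b n) P := by
    intro V hVM P hP
    set ζ : reduceSet n V → ℤˣ := fun v => if (v : Torus d n) ∈ P then 1 else -1 with hζ
    have hpos : posSet ζ = P := by
      ext v
      rw [mem_posSet]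
      constructor
      · rintro ⟨_, h⟩
        by_contra hvP
        simp [hζ, hvP] at h
      · intro h
        exact ⟨hP h, by simp [hζ, h]⟩
    have hNV : Nf V ≤ n :=
      (hN _ (Finset.mem_image_of_mem _ (Finset.mem_powerset.2 hVM))).trans hn
    have := hNf V n hNV ζ
    rw [ising_toOuterMeasure_toReal degree_torusGraph, weight_eq_clusterWeight, hpos] at this
    refine le_trans (le_of_eq ?_) this
    rw [Finset.sum_filter]
    refine Finset.sum_congr rfl fun T _ => ?_
    have hiff : configOf T ∈ {σ : Torus d n → ℤˣ | (fun v : reduceSet n V => σ v) = ζ} ↔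
        T ∩ reduceSet n V = P := by
      rw [Set.mem_ofPred_eq, restrict_configOf_eq_iff, hpos]
    by_cases h : T ∩ reduceSet n V = P
    · rw [if_pos h, Set.indicator_of_mem (hiff.2 h)]
      simp [G, k]
    · rw [if_neg h, Set.indicator_of_notMem (fun h' => h (hiff.1 h'))]
      simp
  have hzero : ∀ U P : Finset (Torus d n), P ⊆ U → (∀ u ∈ U, InBox M u) →
      ∑ T with T ∩ U = P, clusterMass G k (a n) (b n) T ≤
        C * clusterWeight G k (a n) (b n) P := by
    intro U P hP hU
    set V := (intBox d M).filter fun v => (fun i => ((v i : ℤ) : ZMod (n : ℕ))) ∈ U with hV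
    have hVU : reduceSet n V = U := by
      ext u
      simp only [reduceSet, Finset.mem_image]
      constructor
      · rintro ⟨v, hv, rfl⟩
        exact (Finset.mem_filter.1 hv).2
      · intro hu
        obtain ⟨v, hv, hvu⟩ := exists_mem_intBox (hU u hu)
        exact ⟨v, Finset.mem_filter.2 ⟨hv, by rwa [hvu]⟩, hvu⟩
    have hVM : V ⊆ intBox d M := Finset.filter_subset _ _
    have := key V hVM P (by rwa [hVU])
    rw [hVU] at this
    exact this.trans (mul_le_mul_of_nonneg_right (hCle V hVM) (clusterWeight_pos _).le)
  intro x U P hP hU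
  set φ := (translation d p ρ n (-x)).toEquiv.toEmbedding with hφ
  have hφx : ∀ u, φ u = u - x := fun u => (sub_eq_add_neg u x).symm
  have h1 := hzero (U.map φ) (P.map φ) (Finset.map_subset_map.2 hP) (by
    intro u hu
    obtain ⟨v, hv, rfl⟩ := Finset.mem_map.1 hu
    rw [hφx]
    exact hU v hv)
  rw [clusterWeight_map] at h1
  refine le_trans (le_of_eq ?_) h1
  rw [Finset.sum_filter, Finset.sum_filter]
  have h2 := sum_clusterMass_map (k := k) (a := a n) (b := b n) (translation d p ρ n (-x))
    (fun T => if T ∩ U.map φ = P.map φ then 1 else 0)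
  simp only [mul_ite, mul_one, mul_zero] at h2
  rw [← h2]
  refine Finset.sum_congr rfl fun T _ => ?_
  refine if_congr ?_ rfl rfl
  rw [← hφ, ← Finset.map_inter, Finset.map_inj]

section Estimates

variable {M : ℕ} {C : ℝ}

theorem sum_isolatedAt_le (hp : 1 ≤ p) (hρ : 1 ≤ ρ) (hM : 3 * (ρ * (r + 1)) ≤ M)
    (hmarg : MarginalBound p ρ a b d n M C) (x : Torus d n) :
    ∑ T ∈ isolatedAt p ρ n η r x, clusterMass (torusGraph d p ρ n) (torusDegree d p ρ n) a b T ≤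
      C * localWeight p ρ a b n η r := by
  have h0 : 0 ≤ ρ * ((r : ℝ) + 1) := by positivity
  have := hmarg x (window p ρ n r x) (pattern p ρ n η r x) pattern_subset_window
    (fun u hu => (inBox_of_mem_window hp (by linarith) hu).mono (by linarith))
  rwa [clusterWeight_pattern] at this

/-- If `η` occurs at `x` with a negative boundary and also at a nearby `y ≠ x`, then the positive
vertices of `η_y` outside `B(x, r)` form a nonempty cluster that is not adjacent to `η_x`. -/
theorem sum_isolatedAt_inter_le (hp : 1 ≤ p) (hρ : 1 ≤ ρ) (ha : a ≤ 0) (hb : 0 ≤ b) (hC : 0 ≤ C)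
    (hM : 3 * (ρ * (r + 1)) ≤ M) (hn : 4 * (M : ℝ) < ((n : ℕ) : ℝ))
    (hmarg : MarginalBound p ρ a b d n M C) (hpat : (pattern p ρ n η r (0 : Torus d n)).Nonempty)
    {x y : Torus d n} (hxy : y ≠ x) (hnear : ¬ Disjoint (window p ρ n r y) (window p ρ n r x)) :
    ∑ T ∈ isolatedAt p ρ n η r x ∩ isolatedAt p ρ n η r y,
        clusterMass (torusGraph d p ρ n) (torusDegree d p ρ n) a b T ≤
      C * (localWeight p ρ a b n η r * Real.exp (2 * a - 2 * b * torusDegree d p ρ n)) := by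
  have hρ0 : 0 ≤ ρ := by linarith
  have hr0 : (0 : ℝ) ≤ r := Nat.cast_nonneg r
  have hρr : ρ ≤ ρ * ((r : ℝ) + 1) := by nlinarith
  -- If the event is impossible there is nothing to show; otherwise a configuration in it shows
  -- that the positive vertices of `η_x` and `η_y` are compatible.
  rcases (isolatedAt p ρ n η r x ∩ isolatedAt p ρ n η r y).eq_empty_or_nonempty with he | ⟨T₀, hT₀⟩
  · rw [he, Finset.sum_empty]
    have := localWeight_pos (p := p) (ρ := ρ) (a := a) (b := b) (n := n) (η := η) (r := r)
    positivity
  rw [Finset.mem_inter, mem_isolatedAt, mem_isolatedAt] at hT₀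
  obtain ⟨hTx, hTy⟩ := hT₀
  obtain ⟨v, hvy, hvx⟩ := Finset.not_disjoint_iff.1 hnear
  have hyx : InBox (2 * (ρ * (r + 1))) (y - x) := by
    have := (inBox_of_mem_window hp hρ0 hvx).sub (inBox_of_mem_window hp hρ0 hvy)
    rw [sub_sub_sub_cancel_left] at this
    exact this.mono (by linarith)
  set Qx := pattern p ρ n η r x with hQx
  set Qy := pattern p ρ n η r y with hQy
  set R := Qy \ Qx with hR
  have hunion : Qx ∪ Qy = Qx ∪ R := (Finset.union_sdiff_self_eq_union).symm
  have hRx : ∀ u ∈ R, u ∉ window p ρ n r x := by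
    intro u hu hux
    rw [hR, Finset.mem_sdiff] at hu
    refine hu.2 ?_
    rw [← hTx, Finset.mem_inter]
    refine ⟨?_, hux⟩
    rw [← hTy] at hu
    exact (Finset.mem_inter.1 hu.1).1
  have hQxne : Qx.Nonempty := by
    obtain ⟨u, hu⟩ := hpat
    exact ⟨u + x, by rw [hQx, mem_pattern, add_sub_cancel_right]; exact hu⟩
  have hRne : R.Nonempty := by
    obtain ⟨u, hu, hu'⟩ := exists_add_notMem (x := x) hQxne (sub_ne_zero.2 hxy)
      (fun u hu => inBox_of_mem_window hp hρ0 (pattern_subset_window hu)) hyx (by linarith)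
    refine ⟨u + (y - x), Finset.mem_sdiff.2 ⟨?_, hu'⟩⟩
    rw [hQy, mem_pattern]
    rw [hQx, mem_pattern] at hu
    rwa [show u + (y - x) - y = u - x by abel]
  have hRw : clusterWeight (torusGraph d p ρ n) (torusDegree d p ρ n) a b R ≤
      Real.exp (2 * a - 2 * b * torusDegree d p ρ n) :=
    clusterWeight_le_exp hp ha hb hRne (x := y) (M := ρ * (r + 1))
      (fun u hu => inBox_of_mem_window hp hρ0
        (pattern_subset_window (Finset.mem_sdiff.1 hu).1)) (by linarith)
  have hmul : clusterWeight (torusGraph d p ρ n) (torusDegree d p ρ n) a b (Qx ∪ Qy) =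
      localWeight p ρ a b n η r *
        clusterWeight (torusGraph d p ρ n) (torusDegree d p ρ n) a b R := by
    rw [hunion, clusterWeight_union Finset.disjoint_sdiff, hQx, clusterWeight_pattern]
    intro u hu z hz hadj
    exact hRx z hz (mem_window_of_adj (pattern_subset_ball hu) hadj)
  have hbound := hmarg x (window p ρ n r x ∪ window p ρ n r y) (Qx ∪ Qy)
    (Finset.union_subset_union pattern_subset_window pattern_subset_window) (by
      intro u hu
      rcases Finset.mem_union.1 hu with hu | hu
      · exact (inBox_of_mem_window hp hρ0 hu).mono (by linarith)
      · have := (inBox_of_mem_window hp hρ0 hu).add hyx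
        rw [sub_add_sub_cancel] at this
        exact this.mono (by linarith))
  rw [hmul] at hbound
  refine le_trans ?_ (hbound.trans (mul_le_mul_of_nonneg_left
    (mul_le_mul_of_nonneg_left hRw localWeight_pos.le) hC))
  refine Finset.sum_le_sum_of_subset_of_nonneg ?_ fun _ _ _ => clusterMass_nonneg _
  intro T hT
  rw [Finset.mem_inter, mem_isolatedAt, mem_isolatedAt] at hT
  rw [Finset.mem_filter, Finset.inter_union_distrib_left, hT.1, hT.2]
  exact ⟨Finset.mem_univ _, rfl⟩

theorem card_ball_le (hp : 1 ≤ p) (hρ : 1 ≤ ρ) (hM : 3 * (ρ * (r + 1)) ≤ M) (x : Torus d n) :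
    (ball (torusGraph d p ρ n) x r).card ≤ (intBox d M).card :=
  card_le_of_inBox fun _ hu => (inBox_of_mem_window hp (by linarith)
    (ball_subset_window hu)).mono (by
      have : 0 ≤ ρ * ((r : ℝ) + 1) := by positivity
      linarith)

theorem card_boundary_le (hp : 1 ≤ p) (hρ : 1 ≤ ρ) (hM : 3 * (ρ * (r + 1)) ≤ M) (x : Torus d n) :
    (boundary (torusGraph d p ρ n) (ball (torusGraph d p ρ n) x r)).card ≤ (intBox d M).card :=
  card_le_of_inBox fun _ hu => (inBox_of_mem_window hp (by linarith)
    (Finset.mem_union_right _ hu)).mono (by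
      have : 0 ≤ ρ * ((r : ℝ) + 1) := by positivity
      linarith)

/-- The probability that the boundary of `B(x, r)` is not negative. -/
theorem sum_not_disjoint_boundary_le (hp : 1 ≤ p) (hρ : 1 ≤ ρ) (hC : 0 ≤ C)
    (hM : 3 * (ρ * (r + 1)) ≤ M) (hmarg : MarginalBound p ρ a b d n M C) (x : Torus d n) :
    ∑ T with ¬ Disjoint T (boundary (torusGraph d p ρ n) (ball (torusGraph d p ρ n) x r)),
        clusterMass (torusGraph d p ρ n) (torusDegree d p ρ n) a b T ≤
      (intBox d M).card * (C * Real.exp (2 * a - 2 * b * torusDegree d p ρ n)) := by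
  set δ := boundary (torusGraph d p ρ n) (ball (torusGraph d p ρ n) x r) with hδ
  have h1 : ∑ T with ¬ Disjoint T δ,
        clusterMass (torusGraph d p ρ n) (torusDegree d p ρ n) a b T ≤
      ∑ z ∈ δ, ∑ T with T ∩ {z} = {z},
        clusterMass (torusGraph d p ρ n) (torusDegree d p ρ n) a b T := by
    refine sum_le_sum_of_cover (fun T => clusterMass_nonneg T) fun T hT => ?_
    obtain ⟨z, hzT, hz⟩ := Finset.not_disjoint_iff.1 (Finset.mem_filter.1 hT).2
    exact ⟨z, hz, by simp [hzT]⟩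
  refine h1.trans ?_
  have h2 : ∀ z ∈ δ, ∑ T with T ∩ {z} = {z},
        clusterMass (torusGraph d p ρ n) (torusDegree d p ρ n) a b T ≤
      C * Real.exp (2 * a - 2 * b * torusDegree d p ρ n) := by
    intro z _
    have := hmarg z {z} {z} subset_rfl (by
      intro u hu
      rw [Finset.mem_singleton.1 hu, sub_self]
      exact inBox_zero (Nat.cast_nonneg M))
    rwa [clusterWeight_singleton] at this
  refine (Finset.sum_le_card_nsmul _ _ _ h2).trans ?_
  rw [nsmul_eq_mul]
  refine mul_le_mul_of_nonneg_right ?_ (by positivity)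
  exact_mod_cast card_boundary_le hp hρ hM x

/-- The partition function of `B(x, r)` with a negative boundary is close to `1`. -/
theorem sum_powerset_clusterWeight_mem (hp : 1 ≤ p) (hρ : 1 ≤ ρ) (ha : a ≤ 0) (hb : 0 ≤ b)
    (hM : 3 * (ρ * (r + 1)) ≤ M) (hn : 4 * (M : ℝ) < ((n : ℕ) : ℝ)) (x : Torus d n) :
    (∑ R ∈ (ball (torusGraph d p ρ n) x r).powerset,
      clusterWeight (torusGraph d p ρ n) (torusDegree d p ρ n) a b R) ∈
    Set.Icc 1 (1 + 2 ^ (intBox d M).card * Real.exp (2 * a - 2 * b * torusDegree d p ρ n)) := by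
  have hr0 : (0 : ℝ) ≤ r := Nat.cast_nonneg r
  have hρr : ρ ≤ ρ * ((r : ℝ) + 1) := by nlinarith
  rw [← Finset.add_sum_erase _ _ (Finset.empty_mem_powerset _), clusterWeight_empty]
  refine ⟨le_add_of_nonneg_right (Finset.sum_nonneg fun _ _ => (clusterWeight_pos _).le),
    add_le_add_right ?_ _⟩
  refine (Finset.sum_le_card_nsmul _ _ (Real.exp (2 * a - 2 * b * torusDegree d p ρ n)) ?_).trans ?_
  · intro R hR
    rw [Finset.mem_erase, Finset.mem_powerset] at hR
    exact clusterWeight_le_exp hp ha hb (Finset.nonempty_iff_ne_empty.2 hR.1) (x := x)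
      (M := ρ * (r + 1)) (fun u hu => inBox_of_mem_window hp (by linarith)
        (ball_subset_window (hR.2 hu))) (by linarith)
  · rw [nsmul_eq_mul]
    refine mul_le_mul_of_nonneg_right ?_ (Real.exp_pos _).le
    have h1 := (Finset.card_erase_le (s := (ball (torusGraph d p ρ n) x r).powerset)
      (a := ∅)).trans ((Finset.card_powerset _).trans_le
        (Nat.pow_le_pow_right two_pos (card_ball_le hp hρ hM x)))
    exact_mod_cast h1

/-- Whether `η` occurs at `x` with a negative boundary is almost independent of the configuration
outside `B(x, r)`, and has probability almost `W_n(η)`. -/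
theorem abs_sub_sum_isolatedAt_le (hp : 1 ≤ p) (hρ : 1 ≤ ρ) (ha : a ≤ 0) (hb : 0 ≤ b) (hC : 0 ≤ C)
    (hM : 3 * (ρ * (r + 1)) ≤ M) (hn : 4 * (M : ℝ) < ((n : ℕ) : ℝ))
    (hmarg : MarginalBound p ρ a b d n M C) (x : Torus d n) {F : Finset (Torus d n) → ℝ}
    (hF : ∀ T, F T = F (T \ ball (torusGraph d p ρ n) x r)) {c : ℝ} (hFc : ∀ T, |F T| ≤ c) :
    |localWeight p ρ a b n η r *
          ∑ T, clusterMass (torusGraph d p ρ n) (torusDegree d p ρ n) a b T * F T -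
        ∑ T ∈ isolatedAt p ρ n η r x,
          clusterMass (torusGraph d p ρ n) (torusDegree d p ρ n) a b T * F T| ≤
      c * (localWeight p ρ a b n η r * (((intBox d M).card * C + 2 ^ (intBox d M).card) *
        Real.exp (2 * a - 2 * b * torusDegree d p ρ n))) := by
  set G := torusGraph d p ρ n
  set k := torusDegree d p ρ n
  set U := ball G x r with hU
  set w := localWeight p ρ a b n η r with hw
  set w₁ := Real.exp (2 * a - 2 * b * k) with hw₁
  have hw0 : 0 < w := localWeight_pos
  have hc : 0 ≤ c := (abs_nonneg _).trans (hFc ∅)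
  have hmark := sum_clusterMass_eq_of_boundary (G := G) (k := k) (a := a) (b := b) (U := U)
    (P := pattern p ρ n η r x) pattern_subset_ball hF
  obtain ⟨hZ1, hZ2⟩ := sum_powerset_clusterWeight_mem (r := r) hp hρ ha hb hM hn x
  rw [clusterWeight_pattern] at hmark
  set Z := ∑ R ∈ U.powerset, clusterWeight G k a b R with hZ
  have hJ : isolatedAt p ρ n η r x = Finset.univ.filter fun T =>
      T ∩ U = pattern p ρ n η r x ∧ Disjoint T (boundary G U) := by
    ext T
    rw [isolatedAt_iff, Finset.mem_filter]
    simp [hU, G]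
  rw [← hJ] at hmark
  have habs : ∀ s : Finset (Finset (Torus d n)),
      |∑ T ∈ s, clusterMass G k a b T * F T| ≤ c * ∑ T ∈ s, clusterMass G k a b T := by
    intro s
    rw [Finset.mul_sum]
    refine (Finset.abs_sum_le_sum_abs _ _).trans (Finset.sum_le_sum fun T _ => ?_)
    rw [abs_mul, abs_of_nonneg (clusterMass_nonneg T), mul_comm c]
    exact mul_le_mul_of_nonneg_left (hFc T) (clusterMass_nonneg T)
  set E := ∑ T, clusterMass G k a b T * F T with hE
  set EJ := ∑ T ∈ isolatedAt p ρ n η r x, clusterMass G k a b T * F T with hEJ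
  set Eδ := ∑ T with Disjoint T (boundary G U), clusterMass G k a b T * F T with hEδ
  set D := ∑ T with ¬ Disjoint T (boundary G U), clusterMass G k a b T * F T with hD
  have hsum : Eδ + D = E := Finset.sum_filter_add_sum_filter_not _ _ _
  have hDle : |D| ≤ c * ((intBox d M).card * (C * w₁)) :=
    (habs _).trans (mul_le_mul_of_nonneg_left
      (sum_not_disjoint_boundary_le hp hρ hC hM hmarg x) hc)
  have hEδle : |Eδ| ≤ c := by
    refine (habs _).trans ?_
    refine (mul_le_mul_of_nonneg_left (Finset.sum_le_univ_sum_of_nonneg fun T =>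
      clusterMass_nonneg T) hc).trans ?_
    rw [sum_clusterMass, mul_one]
  have hEJle : |EJ| ≤ w * c := by
    have h1 : Z * |EJ| = w * |Eδ| := by
      rw [← abs_of_pos hw0, ← abs_of_pos (zero_lt_one.trans_le hZ1), ← abs_mul, ← abs_mul,
        hmark]
    nlinarith [abs_nonneg EJ, mul_le_mul_of_nonneg_left hEδle hw0.le]
  -- `E` is the full expectation of `F`, and `hmark` reads `Z * EJ = w * (E - D)`.
  have hsplit : w * E - EJ = w * D + (Z - 1) * EJ := by
    rw [← hsum]
    linear_combination -hmark
  rw [hsplit]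
  calc |w * D + (Z - 1) * EJ| ≤ w * |D| + (Z - 1) * |EJ| := by
        refine (abs_add_le _ _).trans (le_of_eq ?_)
        rw [abs_mul, abs_mul, abs_of_pos hw0, abs_of_nonneg (sub_nonneg.2 hZ1)]
    _ ≤ w * (c * ((intBox d M).card * (C * w₁))) +
          (2 ^ (intBox d M).card * w₁) * (w * c) := by
        refine add_le_add (mul_le_mul_of_nonneg_left hDle hw0.le) ?_
        exact mul_le_mul (by linarith) hEJle (abs_nonneg _) (by positivity)
    _ = _ := by ring

/-- The probability that `η` occurs at `x` without a negative boundary. -/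
theorem sum_not_isolatedAt_le (hp : 1 ≤ p) (hρ : 1 ≤ ρ) (hC : 0 ≤ C)
    (hM : 3 * (ρ * (r + 1)) ≤ M) (hmarg : MarginalBound p ρ a b d n M C)
    (hgap : 0 ≤ probGap p ρ a b n η r) (x : Torus d n) :
    ∑ T with T ∩ ball (torusGraph d p ρ n) x r = pattern p ρ n η r x ∧
        T ∉ isolatedAt p ρ n η r x,
        clusterMass (torusGraph d p ρ n) (torusDegree d p ρ n) a b T ≤
      2 ^ (intBox d M).card *
        (C * (probGap p ρ a b n η r * localWeight p ρ a b n η r)) := by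
  set G := torusGraph d p ρ n
  set k := torusDegree d p ρ n
  set δ := boundary G (ball G x r) with hδ
  have h0 : 0 ≤ ρ * ((r : ℝ) + 1) := by positivity
  have hw0 : 0 < localWeight p ρ a b n η r := localWeight_pos
  have hcover : ∑ T with T ∩ ball G x r = pattern p ρ n η r x ∧ T ∉ isolatedAt p ρ n η r x,
        clusterMass G k a b T ≤
      ∑ S ∈ δ.powerset.erase ∅, ∑ T with T ∩ window p ρ n r x = pattern p ρ n η r x ∪ S,
        clusterMass G k a b T := by
    refine sum_le_sum_of_cover (fun T => clusterMass_nonneg T) fun T hT => ?_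
    rw [Finset.mem_filter, isolatedAt_iff] at hT
    obtain ⟨-, hT1, hT2⟩ := hT
    refine ⟨T ∩ δ, ?_, ?_⟩
    · rw [Finset.mem_erase, Finset.mem_powerset]
      refine ⟨fun h => hT2 ⟨hT1, Finset.disjoint_iff_inter_eq_empty.2 h⟩,
        Finset.inter_subset_right⟩
    · rw [Finset.mem_filter, window, Finset.inter_union_distrib_left, hT1]
      exact ⟨Finset.mem_univ _, rfl⟩
  refine hcover.trans ((Finset.sum_le_card_nsmul _ _
    (C * (probGap p ρ a b n η r * localWeight p ρ a b n η r)) ?_).trans ?_)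
  · intro S hS
    rw [Finset.mem_erase, Finset.mem_powerset] at hS
    refine (hmarg x (window p ρ n r x) (pattern p ρ n η r x ∪ S)
      (Finset.union_subset_union pattern_subset_ball hS.2)
      (fun u hu => (inBox_of_mem_window hp (by linarith) hu).mono (by linarith))).trans ?_
    exact mul_le_mul_of_nonneg_left
      (clusterWeight_pattern_union_le (Finset.nonempty_iff_ne_empty.2 hS.1) hS.2) hC
  · rw [nsmul_eq_mul]
    refine mul_le_mul_of_nonneg_right ?_ (by positivity)
    have h1 := (Finset.card_erase_le (s := δ.powerset)
      (a := ∅)).trans ((Finset.card_powerset _).trans_le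
        (Nat.pow_le_pow_right two_pos (card_boundary_le hp hρ hM x)))
    exact_mod_cast h1

/-! ### The Poisson approximation -/

/-- The number of occurrences of `η` with a negative boundary. -/
def isolatedCount (p : ℝ≥0∞) (ρ : ℝ) (n : ℕ+) (η : (Fin d → ℤ) → ℤˣ) (r : ℕ)
    (T : Finset (Torus d n)) : ℕ := ∑ x, if T ∈ isolatedAt p ρ n η r x then 1 else 0

/-- Total variation bound for the number of isolated occurrences, by the Chen–Stein method. -/
theorem abs_sum_isolatedCount_sub_poisson_le (hp : 1 ≤ p) (hρ : 1 ≤ ρ) (ha : a ≤ 0) (hb : 0 ≤ b)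
    (hC : 0 ≤ C) (hM : 3 * (ρ * (r + 1)) ≤ M) (hn : 4 * (M : ℝ) < ((n : ℕ) : ℝ))
    (hmarg : MarginalBound p ρ a b d n M C) (hpat : (pattern p ρ n η r (0 : Torus d n)).Nonempty)
    {lam : ℝ≥0} (hlam : 0 < lam)
    (hW : ((n : ℕ) : ℝ) ^ d * localWeight p ρ a b n η r = lam) (A : Set ℕ) :
    |∑ T, clusterMass (torusGraph d p ρ n) (torusDegree d p ρ n) a b T *
          A.indicator 1 (isolatedCount p ρ n η r T) -
        (ProbabilityTheory.poissonMeasure lam).real A| ≤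
      Real.exp lam * ((5 * C * (intBox d M).card + 2 ^ (intBox d M).card) *
        Real.exp (2 * a - 2 * b * torusDegree d p ρ n)) := by
  have hl : (0 : ℝ) < lam := hlam
  have hr0 : (0 : ℝ) ≤ r := Nat.cast_nonneg r
  have hρ0 : 0 ≤ ρ := by linarith
  have hρr : ρ ≤ ρ * ((r : ℝ) + 1) := by nlinarith
  set K := (intBox d M).card
  set G := torusGraph d p ρ n
  set k := torusDegree d p ρ n
  set w := localWeight p ρ a b n η r with hw
  set w₁ := Real.exp (2 * a - 2 * b * k) with hw₁
  have hw0 : 0 < w := localWeight_pos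
  have hw₁0 : 0 < w₁ := Real.exp_pos _
  have hww₁ : w ≤ w₁ := by
    rw [hw, ← clusterWeight_pattern 0]
    exact clusterWeight_le_exp hp ha hb hpat (x := 0) (M := ρ * (r + 1))
      (fun u hu => inBox_of_mem_window hp hρ0 (pattern_subset_window hu)) (by linarith)
  set J := isolatedAt p ρ n η r with hJ
  set N : Torus d n → Finset (Torus d n) := fun x =>
    Finset.univ.filter fun y => ¬ Disjoint (window p ρ n r y) (window p ρ n r x) with hN
  have hNx : ∀ x, x ∈ N x := by
    intro x
    rw [hN, Finset.mem_filter]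
    refine ⟨Finset.mem_univ _, ?_⟩
    rw [disjoint_self, Finset.bot_eq_empty]
    exact Finset.Nonempty.ne_empty ⟨x, ball_subset_window (by simp [ball])⟩
  have hNcard : ∀ x, ((N x).card : ℝ) ≤ K := by
    intro x
    have : (N x).card ≤ K := card_le_of_inBox (x := x) fun y hy => by
      obtain ⟨v, hvy, hvx⟩ := Finset.not_disjoint_iff.1 (Finset.mem_filter.1 hy).2
      have := (inBox_of_mem_window hp hρ0 hvx).sub (inBox_of_mem_window hp hρ0 hvy)
      rw [sub_sub_sub_cancel_left] at this
      exact this.mono (by linarith)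
    exact_mod_cast this
  obtain ⟨f, hf, hfeq⟩ := exists_stein_solution hlam A
  set c := Real.exp lam / lam with hc
  have hc0 : 0 < c := by positivity
  set e := w * ((K * C + 2 ^ K) * w₁) with he
  have hcard : ((Fintype.card (Torus d n) : ℕ) : ℝ) * w = lam := by
    rw [← hW, Fintype.card_fun, ZMod.card, Fintype.card_fin]
    push_cast
    rfl
  have hstein := chen_stein_bound (m := clusterMass G k a b) (fun T => clusterMass_nonneg T) J N
    hNx (e := e) hw0.le hcard hf (fun x g hg => by
      refine abs_sub_sum_isolatedAt_le hp hρ ha hb hC hM hn hmarg x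
        (F := fun T => g (∑ y ∈ (N x)ᶜ, if T ∈ J y then 1 else 0)) ?_ fun T => hg _
      intro T
      congr 1
      refine Finset.sum_congr rfl fun y hy => if_congr ?_ rfl rfl
      have hdisj : Disjoint (window p ρ n r y) (ball G x r) := by
        by_contra h
        refine Finset.mem_compl.1 hy (Finset.mem_filter.2 ⟨Finset.mem_univ _, fun h' => h ?_⟩)
        exact h'.mono_right ball_subset_window
      rw [mem_isolatedAt, mem_isolatedAt, Finset.sdiff_inter_right_comm,
        Finset.sdiff_eq_self_of_disjoint (hdisj.mono_left Finset.inter_subset_right)])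
  have hlhs : ∑ T, clusterMass G k a b T * A.indicator 1 (isolatedCount p ρ n η r T) -
      (ProbabilityTheory.poissonMeasure lam).real A =
      ∑ T, clusterMass G k a b T * (lam * f ((∑ y, if T ∈ J y then 1 else 0) + 1) -
        ((∑ y, if T ∈ J y then 1 else 0 : ℕ) : ℝ) * f (∑ y, if T ∈ J y then 1 else 0)) := by
    simp only [hfeq, mul_sub]
    rw [Finset.sum_sub_distrib, ← Finset.sum_mul, sum_clusterMass, one_mul]
    rfl
  rw [hlhs]
  refine hstein.trans ?_
  have hterm : ∀ x ∈ (Finset.univ : Finset (Torus d n)),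
      2 * w * ∑ y ∈ N x, ∑ T ∈ J y, clusterMass G k a b T +
        2 * ∑ y ∈ (N x).erase x, ∑ T ∈ J x ∩ J y, clusterMass G k a b T + e ≤
      w * ((5 * C * K + 2 ^ K) * w₁) := by
    intro x _
    have h1 : ∑ y ∈ N x, ∑ T ∈ J y, clusterMass G k a b T ≤ K * (C * w₁) := by
      refine (Finset.sum_le_card_nsmul _ _ (C * w₁) fun y _ =>
        (sum_isolatedAt_le hp hρ hM hmarg y).trans (mul_le_mul_of_nonneg_left hww₁ hC)).trans ?_
      rw [nsmul_eq_mul]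
      exact mul_le_mul_of_nonneg_right (hNcard x) (by positivity)
    have h2 : ∑ y ∈ (N x).erase x, ∑ T ∈ J x ∩ J y, clusterMass G k a b T ≤
        K * (C * (w * w₁)) := by
      refine (Finset.sum_le_card_nsmul _ _ (C * (w * w₁)) fun y hy => ?_).trans ?_
      · rw [Finset.mem_erase] at hy
        exact sum_isolatedAt_inter_le hp hρ ha hb hC hM hn hmarg hpat hy.1
          (Finset.mem_filter.1 hy.2).2
      · rw [nsmul_eq_mul]
        refine mul_le_mul_of_nonneg_right (le_trans ?_ (hNcard x)) (by positivity)
        exact_mod_cast Finset.card_erase_le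
    have h3 := mul_le_mul_of_nonneg_left h1 (show 0 ≤ 2 * w by positivity)
    rw [he]
    linarith
  refine (mul_le_mul_of_nonneg_left (Finset.sum_le_card_nsmul _ _ _ hterm) hc0.le).trans
    (le_of_eq ?_)
  rw [nsmul_eq_mul, Finset.card_univ, ← mul_assoc (Fintype.card (Torus d n) : ℝ), hcard, hc]
  field_simp

/-- Total variation bound for the number of all occurrences. -/
theorem abs_sum_occurrences_sub_poisson_le (hd : 1 ≤ d) (hp : 1 ≤ p) (hρ : 1 ≤ ρ) (ha : a ≤ 0)
    (hb : 0 ≤ b) (hC : 0 ≤ C) (hM : 3 * (ρ * (r + 1)) ≤ M) (hn : 4 * (M : ℝ) < ((n : ℕ) : ℝ))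
    (hmarg : MarginalBound p ρ a b d n M C) (hpat : (pattern p ρ n η r (0 : Torus d n)).Nonempty)
    {lam : ℝ≥0} (hlam : 0 < lam)
    (hW : ((n : ℕ) : ℝ) ^ d * localWeight p ρ a b n η r = lam) (A : Set ℕ) :
    |∑ T, clusterMass (torusGraph d p ρ n) (torusDegree d p ρ n) a b T *
          A.indicator 1 (occurrences p ρ n η r (configOf T)) -
        (ProbabilityTheory.poissonMeasure lam).real A| ≤
      (Real.exp lam * (5 * C * (intBox d M).card + 2 ^ (intBox d M).card) +
        lam * (2 ^ (intBox d M).card * C)) * probGap p ρ a b n η r := by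
  have hr0 : (0 : ℝ) ≤ r := Nat.cast_nonneg r
  have hnr : 2 * ρ * ((r : ℝ) + 1) < ((n : ℕ) : ℝ) := by
    have : 0 ≤ ρ * ((r : ℝ) + 1) := by positivity
    nlinarith
  have hgap := exp_le_probGap (a := a) (η := η) hd hp hρ hb hnr
  have hgap0 : 0 < probGap p ρ a b n η r := (Real.exp_pos _).trans_le hgap
  set K := (intBox d M).card
  set G := torusGraph d p ρ n
  set k := torusDegree d p ρ n
  set w := localWeight p ρ a b n η r with hw
  set X : Finset (Torus d n) → ℕ := fun T => occurrences p ρ n η r (configOf T) with hX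
  set S := isolatedCount p ρ n η r with hS
  have h1 := abs_sum_isolatedCount_sub_poisson_le hp hρ ha hb hC hM hn hmarg hpat hlam hW A
  have hcard : ((Fintype.card (Torus d n) : ℕ) : ℝ) * w = lam := by
    rw [← hW, Fintype.card_fun, ZMod.card, Fintype.card_fin]
    push_cast
    rfl
  have h2 : |∑ T, clusterMass G k a b T * A.indicator 1 (X T) -
      ∑ T, clusterMass G k a b T * A.indicator 1 (S T)| ≤
      lam * (2 ^ K * C) * probGap p ρ a b n η r := by
    calc |∑ T, clusterMass G k a b T * A.indicator 1 (X T) -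
          ∑ T, clusterMass G k a b T * A.indicator 1 (S T)|
        ≤ ∑ T with X T ≠ S T, clusterMass G k a b T := by
          rw [← Finset.sum_sub_distrib, Finset.sum_filter]
          refine (Finset.abs_sum_le_sum_abs _ _).trans (Finset.sum_le_sum fun T _ => ?_)
          split_ifs with h
          · rw [← mul_sub, abs_mul, abs_of_nonneg (clusterMass_nonneg T)]
            refine mul_le_of_le_one_right (clusterMass_nonneg T) ?_
            by_cases hx : X T ∈ A <;> by_cases hs : S T ∈ A <;> simp [hx, hs]
          · rw [not_not.1 h, sub_self, abs_zero]
      _ ≤ ∑ x, ∑ T with T ∩ ball G x r = pattern p ρ n η r x ∧ T ∉ isolatedAt p ρ n η r x,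
            clusterMass G k a b T := by
          refine sum_le_sum_of_cover (fun T => clusterMass_nonneg T) fun T hT => ?_
          by_contra! hcon
          refine (Finset.mem_filter.1 hT).2 ?_
          simp only [hX, hS, isolatedCount, occurrences_configOf]
          refine Finset.sum_congr rfl fun x hx => if_congr ⟨fun h => ?_, fun h => ?_⟩ rfl rfl
          · by_contra h'
            exact hcon x hx (Finset.mem_filter.2 ⟨Finset.mem_univ _, h, h'⟩)
          · exact (isolatedAt_iff.1 h).1
      _ ≤ Fintype.card (Torus d n) • (2 ^ K * (C * (probGap p ρ a b n η r * w))) :=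
          Finset.sum_le_card_nsmul _ _ _ fun x _ =>
            sum_not_isolatedAt_le hp hρ hC hM hmarg hgap0.le x
      _ = lam * (2 ^ K * C) * probGap p ρ a b n η r := by
          rw [nsmul_eq_mul, ← hcard]
          ring
  have h3 := mul_le_mul_of_nonneg_left hgap
    (show 0 ≤ Real.exp lam * (5 * C * K + 2 ^ K) by positivity)
  have h4 := abs_sub_le (∑ T, clusterMass G k a b T * A.indicator 1 (X T))
    (∑ T, clusterMass G k a b T * A.indicator 1 (S T))
    ((ProbabilityTheory.poissonMeasure lam).real A)
  rw [← mul_assoc] at h1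
  linarith

end Estimates

theorem occurrencesLaw_real (A : Set ℕ) :
    (occurrencesLaw p ρ a b n η r).real A =
      ∑ T, clusterMass (torusGraph d p ρ n) (torusDegree d p ρ n) a b T *
        A.indicator 1 (occurrences p ρ n η r (configOf T)) := by
  rw [MeasureTheory.measureReal_def, occurrencesLaw,
    PMF.toMeasure_apply_eq_toOuterMeasure, PMF.toOuterMeasure_map_apply,
    ising_toOuterMeasure_toReal degree_torusGraph]
  rfl

theorem tvDist_le_one {Ω : Type*} [MeasurableSpace Ω] (μ ν : MeasureTheory.Measure Ω)
    [MeasureTheory.IsProbabilityMeasure μ] [MeasureTheory.IsProbabilityMeasure ν] :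
    tvDist μ ν ≤ 1 := by
  have : Nonempty {A : Set Ω // MeasurableSet A} := ⟨⟨∅, MeasurableSet.empty⟩⟩
  refine ciSup_le fun A => ?_
  have h1 : 0 ≤ μ.real A.1 := MeasureTheory.measureReal_nonneg
  have h2 : 0 ≤ ν.real A.1 := MeasureTheory.measureReal_nonneg
  have h3 : μ.real A.1 ≤ 1 := MeasureTheory.measureReal_le_one
  have h4 : ν.real A.1 ≤ 1 := MeasureTheory.measureReal_le_one
  rw [abs_le]
  constructor <;> linarith

/-- An empty pattern would have weight `1`, which is more than `λ / n ^ d` if `λ < n`. -/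
theorem pattern_nonempty (hd : 1 ≤ d) {lam : ℝ≥0}
    (hW : ((n : ℕ) : ℝ) ^ d * localWeight p ρ a b n η r = lam) (hlam : (lam : ℝ) < (n : ℕ)) :
    (pattern p ρ n η r (0 : Torus d n)).Nonempty := by
  by_contra h
  rw [← clusterWeight_pattern 0, Finset.not_nonempty_iff_eq_empty.1 h, clusterWeight_empty,
    mul_one] at hW
  have h2 : ((n : ℕ) : ℝ) ≤ ((n : ℕ) : ℝ) ^ d := by
    refine le_self_pow₀ ?_ (by omega)
    exact_mod_cast n.pos
  linarith

end Pattern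

/-- A bound from some index on extends to the finitely many previous indices. -/
theorem exists_forall_le_mul_of_eventually {t D : ℕ+ → ℝ} {n₀ N : ℕ+} {C : ℝ}
    (ht : ∀ n, t n ≤ 1) (hD : ∀ n, n₀ ≤ n → 0 < D n)
    (h : ∀ n, n₀ ≤ n → N ≤ n → t n ≤ C * D n) :
    ∃ C' : ℝ, 0 < C' ∧ ∀ n, n₀ ≤ n → t n ≤ C' * D n := by
  obtain ⟨B, hB⟩ := ((Finset.Icc n₀ N).image fun n => (D n)⁻¹).exists_le
  refine ⟨max (max B C) 1, lt_max_of_lt_right one_pos, fun n hn => ?_⟩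
  rcases le_total N n with hNn | hnN
  · refine (h n hn hNn).trans (mul_le_mul_of_nonneg_right ?_ (hD n hn).le)
    exact (le_max_right _ _).trans (le_max_left _ _)
  · have h1 := hB _ (Finset.mem_image_of_mem _ (Finset.mem_Icc.2 ⟨hn, hnN⟩))
    calc t n ≤ 1 := ht n
      _ = (D n)⁻¹ * D n := (inv_mul_cancel₀ (hD n hn).ne').symm
      _ ≤ _ := mul_le_mul_of_nonneg_right
        (h1.trans ((le_max_left _ _).trans (le_max_left _ _))) (hD n hn).le

end IsingPoisson

end

theorem theorem3p1 (d : ℕ) (hd : 1 ≤ d) (p : ENNReal) (hp : 1 ≤ p) (ρ : ℝ) (hρ : 1 ≤ ρ)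
    (r : ℕ) (hr : 1 ≤ r) (η : (Fin d → ℤ) → ℤˣ) (lam : NNReal) (hlam : 0 < lam)
    (a b : ℕ+ → ℝ) (n₀ : ℕ+) (hn₀ : 2 * ρ * ((r : ℝ) + 1) < ((n₀ : ℕ) : ℝ))
    (ha : ∀ n, n₀ ≤ n → a n < 0) (hb : ∀ n, n₀ ≤ n → 0 ≤ b n)
    (hW : ∀ n, n₀ ≤ n →
      ((n : ℕ) : ℝ) ^ d * IsingPoisson.localWeight p ρ (a n) (b n) n η r = (lam : ℝ))
    (H1 : IsingPoisson.HypGap p ρ a b η r)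
    (H2 : IsingPoisson.HypWeight d p ρ a b) :
    ∃ C : ℝ, 0 < C ∧ ∀ n, n₀ ≤ n →
      IsingPoisson.tvDist (IsingPoisson.occurrencesLaw p ρ (a n) (b n) n η r)
          (ProbabilityTheory.poissonMeasure lam)
        ≤ C * max (IsingPoisson.probGap p ρ (a n) (b n) n η r)
            (IsingPoisson.maxProb p ρ (a n) (b n) n η r) := by
  open IsingPoisson in
  -- Windows of nearby points lie in a common box of size `3 ρ (r + 1)`.
  obtain ⟨M, hM⟩ := exists_nat_ge (3 * (ρ * ((r : ℝ) + 1)))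
  obtain ⟨C, hC, N, hN⟩ := exists_marginalBound H2 M
  obtain ⟨N', hN'⟩ := exists_nat_gt (max (4 * (M : ℝ)) lam)
  have hgap : ∀ n, n₀ ≤ n → 0 < probGap p ρ (a n) (b n) n η r := fun n hn =>
    (Real.exp_pos _).trans_le (exp_le_probGap hd hp hρ (hb n hn)
      (hn₀.trans_le (by exact_mod_cast hn)))
  refine exists_forall_le_mul_of_eventually (N := N + N'.succPNat)
    (fun n => by
      have : MeasureTheory.IsProbabilityMeasure (occurrencesLaw p ρ (a n) (b n) n η r) :=
        PMF.toMeasure.isProbabilityMeasure _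
      exact tvDist_le_one _ _)
    (fun n hn => (hgap n hn).trans_le (le_max_left _ _))
    (C := Real.exp lam * (5 * C * (intBox d M).card + 2 ^ (intBox d M).card) +
      lam * (2 ^ (intBox d M).card * C)) fun n hn hNn => ?_
  have hnN : N ≤ n := le_trans (by exact_mod_cast Nat.le_add_right _ _) hNn
  have hnN' : max (4 * (M : ℝ)) lam < ((n : ℕ) : ℝ) := by
    refine hN'.trans_le ?_
    have : (N'.succPNat : ℕ) ≤ n :=
      le_trans (by exact_mod_cast Nat.le_add_left _ _) (PNat.coe_le_coe _ _ |>.2 hNn)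
    rw [Nat.succPNat_coe] at this
    exact_mod_cast (Nat.le_succ _).trans this
  have : Nonempty {A : Set ℕ // MeasurableSet A} := ⟨⟨∅, MeasurableSet.empty⟩⟩
  refine ciSup_le fun A => ?_
  rw [occurrencesLaw_real]
  refine (abs_sum_occurrences_sub_poisson_le hd hp hρ (ha n hn).le (hb n hn) hC.le hM
    ((le_max_left _ _).trans_lt hnN') (hN n hnN)
    (pattern_nonempty hd (hW n hn) ((le_max_right _ _).trans_lt hnN')) hlam (hW n hn) A.1).trans
    (mul_le_mul_of_nonneg_left (le_max_left _ _) (by positivity))
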